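/- **Setting.** Let $w_1,\dots,w_K>0$ with $\sum_j w_j=1$, let $\mu_1,\dots,\mu_K\in\mathbb{R}^d$, and let the data follow the Gaussian mixture $\sum_j w_j\,\mathcal N(\mu_j,I)$. The training set $X$ consists of independent points, $n_j$ of them with label $j$ and law $\mathcal N(\mu_j,I)$; write $x_{j,i}$ for the $i$-th point with label $j$. For $t>0$ put $r_t=e^{-t}$ and $\sigma_t=\sqrt{1-e^{-2t}}$. The denoising network is $\epsilon_\theta(x,y,c)=\sum_{j}\mathbf 1_{y=j}(W_t^j x+V_t^j c)$ with trainable matrices $W_t^j\in\mathbb{R}^{d\times d}$, $V_t^j\in\mathbb{R}^{d\times K}$; let $e_j\in\mathbb{R}^K$ be the one-hot encoding of the label $j$. For a corruption level $\gamma\ge 0$ the network is trained to optimality: for every $t>0$ its parameters minimize $$\sum_{j=1}^K\frac{w_j}{n_j}\sum_{i=1}^{n_j}\mathbb E_{\xi,\epsilon}\big\|\epsilon_\theta(r_tx_{j,i}+\sigma_t\epsilon,\;j,\;e_j+\gamma\xi)-\epsilon\big\|_2^2,\qquad \epsilon\sim\mathcal N(0,I_d),\ \xi\sim\mathcal N(0,I_K)\text{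 independent}$$ (for $n_j=0$ the $j$-th summand is $0$). For a class $k$ with $n_k\ge1$ and a length $T>0$, the generated distribution is the law of $z_T$, where $z_0\sim\mathcal N(0,I_d)$ and $z$ is continuous on $[0,T]$ and solves the reverse ODE $\dot z_s=z_s-\sigma_{T-s}^{-1}\,\epsilon_\theta(z_s,k,e_k)$ on $0\le s<T$, with the parameters taken at time $T-s$. Let $\mathbb P=\mathcal N(\mu_k,I)$, let $\mathbb Q_X$ be the generated distribution of the clean model ($\gamma=0$), and let $\mathbb Q^c_X$ be that of the model trained with corruption level $\gamma$. Let $\mathcal W_2$ be the 2-Wasserstein distance. **Theorem.** For every $B$ there are constants $c_0,\kappa>0$, depending only on $B$, such that the following holds for all $K$, $d$, all mixtures, all sample sizes and every class $k$ with $\|\mu_k\|_2^2\le B$ and $n_k\ge 1$. If $0\le\gamma\le c_0/\sqrt{\max_j n_j}$, then for all sufficiently large $T$ the distributions $\mathbb Q_X$ and $\mathbb Q_X^c$ are well defined (they exist and are unique for every $X$), their 2-Wasserstein distances to $\mathbb P$ are finite for every $X$, the squares of these distances are integrable over the random training set, and $$\mathbb E_X\big[\mathcal W_2^2(\mathbb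 P,\mathbb Q_X)-\mathcal W_2^2(\mathbb P,\mathbb Q_X^c)\big]\;\ge\;\kappa\,\frac{\gamma^2 d}{n_k}.$$ In particular, for $\gamma>0$ and $d\geq 1$ the corruptly trained model is strictly closer to the true class distribution in expected squared 2-Wasserstein distance. -/

import Mathlib

open MeasureTheory ProbabilityTheory Filter
open scoped ENNReal

noncomputable section

/-- Euclidean space `ℝ^d` with its Euclidean norm. -/
abbrev Euc (d : ℕ) : Type := EuclideanSpace ℝ (Fin d)

/-! ### Data -/

/-- The parameters of a Gaussian mixture `∑ k, w k • N(μ k, I)` on `ℝ^d` with `K` classes. -/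
structure GaussianMixture (K d : ℕ) where
  /-- the class weights -/
  w : Fin K → ℝ
  /-- the class means -/
  μ : Fin K → Euc d
  w_pos : ∀ k, 0 < w k
  w_sum : ∑ k, w k = 1

/-- The law `N(μ k, I)` of a data point of class `k`. -/
def GaussianMixture.classLaw {K d : ℕ} (G : GaussianMixture K d) (k : Fin K) : Measure (Euc d) :=
  multivariateGaussian (G.μ k) 1

/-- A labelled data set with `n k` points of class `k`. -/
abbrev Dataset {K : ℕ} (n : Fin K → ℕ) (d : ℕ) : Type := (k : Fin K) → Fin (n k) → Euc d

/-- The law of a random training set: all points independent, those of class `k` distributed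
as `N(μ k, I)`. -/
def GaussianMixture.sampleLaw {K d : ℕ} (G : GaussianMixture K d) (n : Fin K → ℕ) :
    Measure (Dataset n d) :=
  Measure.pi fun k => Measure.pi fun _ : Fin (n k) => G.classLaw k

/-! ### Forward process and denoising network -/

/-- Signal coefficient of the Ornstein-Uhlenbeck forward process,
`x_t = signal t • x + noise t • ε`. -/
def signal (t : ℝ) : ℝ := Real.exp (-t)

/-- Noise coefficient of the Ornstein-Uhlenbeck forward process. -/
def noise (t : ℝ) : ℝ := Real.sqrt (1 - Real.exp (-2 * t))

/-- The one-hot encoding of a label. -/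
def oneHot {K : ℕ} (k : Fin K) : Euc K := EuclideanSpace.single k 1

/-- The parameters (at one time `t`) of the piecewise linear denoising network; for every class a
`d × d` matrix `W k` and a `d × K` matrix `V k`, viewed as linear maps. -/
structure LinearDenoiser (K d : ℕ) where
  W : Fin K → Euc d →L[ℝ] Euc d
  V : Fin K → Euc K →L[ℝ] Euc d

/-- The output `∑ k, 1_{y = k} (W k x + V k c)` of the network at the point `x`, label `y` and
label embedding `c`. -/
def LinearDenoiser.eval {K d : ℕ} (θ : LinearDenoiser K d) (x : Euc d) (y : Fin K) (c : Euc K) :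
    Euc d :=
  ∑ k, if y = k then θ.W k x + θ.V k c else 0

/-- The training loss at time `t` on the data set `X`, when the label embedding `oneHot k` is
replaced by `oneHot k + γ • ξ` with standard Gaussian `ξ`. The clean loss is the case `γ = 0`. -/
def trainingLoss {K d : ℕ} {n : Fin K → ℕ} (w : Fin K → ℝ) (X : Dataset n d) (γ t : ℝ)
    (θ : LinearDenoiser K d) : ℝ :=
  ∑ k, w k / (n k : ℝ) * ∑ i : Fin (n k),
    ∫ ξ, ∫ ε, ‖θ.eval (signal t • X k i + noise t • ε) k (oneHot k + γ • ξ) - ε‖ ^ 2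
      ∂(stdGaussian (Euc d)) ∂(stdGaussian (Euc K))

/-- The network is trained to optimality: at every time `t > 0` its parameters are a global
minimizer of the training loss. -/
def IsTrained {K d : ℕ} {n : Fin K → ℕ} (w : Fin K → ℝ) (X : Dataset n d) (γ : ℝ)
    (θ : ℝ → LinearDenoiser K d) : Prop :=
  ∀ t : ℝ, 0 < t → ∀ θ' : LinearDenoiser K d,
    trainingLoss w X γ t (θ t) ≤ trainingLoss w X γ t θ'

/-! ### Generation -/

/-- The estimate `-ε_θ(x, k) / σ_t` of the conditional score at time `t` given by the network
(evaluated at the uncorrupted embedding of the label `k`). -/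
def scoreEstimate {K d : ℕ} (θ : ℝ → LinearDenoiser K d) (k : Fin K) (t : ℝ) (x : Euc d) : Euc d :=
  -((noise t)⁻¹ • (θ t).eval x k (oneHot k))

/-- `Φ s z` is the value at time `s` of the solution, started at `z`, of the reverse ODE
`dz_s = (z_s + score_{T - s}(z_s)) ds`, `0 ≤ s < T`; the solution is continuous up to the
final time `T`, where the estimated score may be singular. -/
def IsReverseFlow {K d : ℕ} (θ : ℝ → LinearDenoiser K d) (k : Fin K) (T : ℝ)
    (Φ : ℝ → Euc d → Euc d) : Prop :=
  ∀ z : Euc d, Φ 0 z = z ∧ ContinuousOn (fun s => Φ s z) (Set.Icc 0 T) ∧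
    ∀ s ∈ Set.Ico 0 T, HasDerivWithinAt (fun u => Φ u z)
      (Φ s z + scoreEstimate θ k (T - s) (Φ s z)) (Set.Icc 0 T) s

/-- `Q` is the law of the output `z_T` for class `k` of a model trained on `X` with corruption
level `γ`, the reverse ODE being started at `z_0 ∼ N(0, I)`. -/
def IsGenerationLaw {K d : ℕ} {n : Fin K → ℕ} (w : Fin K → ℝ) (X : Dataset n d) (γ : ℝ)
    (k : Fin K) (T : ℝ) (Q : Measure (Euc d)) : Prop :=
  ∃ (θ : ℝ → LinearDenoiser K d) (Φ : ℝ → Euc d → Euc d),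
    IsTrained w X γ θ ∧ IsReverseFlow θ k T Φ ∧ Measurable (Φ T) ∧
      Q = (stdGaussian (Euc d)).map (Φ T)

/-! ### Wasserstein distance -/

/-- The 2-Wasserstein distance between two measures on `ℝ^d`. -/
def wasserstein2 {d : ℕ} (P Q : Measure (Euc d)) : ℝ≥0∞ :=
  (⨅ (π : Measure (Euc d × Euc d)) (_ : π.fst = P ∧ π.snd = Q),
    ∫⁻ p, edist p.1 p.2 ^ 2 ∂π) ^ (1 / 2 : ℝ)

end

/-!
The optimal network depends on the points of the class only through their mean `m` and covariance
`S`. Corrupting the label amounts to ridge regression on it, which shrinks the part of the mean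
attributed to the label by the factor `1 - ρ`, where `ρ = γ² / (1 + γ²)`, and moves what is lost
into the covariance: the learned score is that of the noised `N((1 - ρ) m, S + ρ m mᵀ)`. As this
score is affine, the reverse ODE is solved explicitly in an eigenbasis of `S + ρ m mᵀ`, the
generated law is Gaussian, and its squared distance to `N(μ, I)` is the squared error of the mean
plus the sum of the squared errors of the standard deviations.

As `T → ∞` the gain from the corruption becomes
`‖μ - m‖² - ‖μ - (1 - ρ) m‖² - ρ ‖m‖² + 2 tr (√(S + ρ m mᵀ) - √S)`. With `q = d / n` for `n`
points, the mean part has expectation `q ρ (1 - ρ) - ρ (1 + ρ) ‖μ‖²`, so the trace part has to make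
up for the bias `ρ ‖μ‖²`. By Peierls' inequality `tr √S` is at most the sum of the square roots of
the diagonal entries of `S` in an eigenbasis of `S + ρ m mᵀ`, so the trace part can be bounded below
coordinatewise; as `x i - m` is independent of `m` with covariance at most the identity, its
expectation is at least `ρ 𝔼‖m‖²` up to second order in `ρ`.
-/

noncomputable section

/-! ### Second moments of the standard Gaussian -/

section GaussianMoments

variable {E F : Type*} [NormedAddCommGroup E] [InnerProductSpace ℝ E] [FiniteDimensional ℝ E]
  [MeasurableSpace E] [BorelSpace E] [NormedAddCommGroup F] [InnerProductSpace ℝ F]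

lemma memLp_add_inner_stdGaussian (α : ℝ) (v : E) :
    MemLp (fun ε => α + inner ℝ v ε) 2 (stdGaussian E) :=
  (memLp_const α).add (IsGaussian.memLp_two_id.const_inner v)

lemma integral_add_inner_stdGaussian (α : ℝ) (v : E) :
    ∫ ε, (α + inner ℝ v ε) ∂(stdGaussian E) = α := by
  have hv : MemLp (fun ε => inner ℝ v ε) 2 (stdGaussian E) :=
    IsGaussian.memLp_two_id.const_inner v
  rw [integral_add (integrable_const _) (hv.integrable one_le_two)]
  simpa using integral_strongDual_stdGaussian (innerSL ℝ v)

lemma variance_add_inner_stdGaussian (α : ℝ) (v : E) :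
    Var[fun ε => α + inner ℝ v ε; stdGaussian E] = ‖v‖ ^ 2 := by
  have hv : MemLp (fun ε => inner ℝ v ε) 2 (stdGaussian E) :=
    IsGaussian.memLp_two_id.const_inner v
  rw [variance_const_add hv.aestronglyMeasurable]
  simpa using variance_dual_stdGaussian (innerSL ℝ v)

lemma integral_add_inner_sq_stdGaussian (α : ℝ) (v : E) :
    ∫ ε, (α + inner ℝ v ε) ^ 2 ∂(stdGaussian E) = α ^ 2 + ‖v‖ ^ 2 := by
  have h := variance_eq_sub (memLp_add_inner_stdGaussian α v)
  simp only [Pi.pow_apply, variance_add_inner_stdGaussian, integral_add_inner_stdGaussian] at h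
  linarith

variable {ι : Type*} [Fintype ι]

lemma integrable_norm_add_apply_sq_stdGaussian (a : F) (L : E →L[ℝ] F) :
    Integrable (fun ε => ‖a + L ε‖ ^ 2) (stdGaussian E) :=
  ((memLp_const a).add (L.comp_memLp' IsGaussian.memLp_two_id)).norm.integrable_sq

lemma integral_norm_add_apply_sq_stdGaussian [FiniteDimensional ℝ F]
    (b : OrthonormalBasis ι ℝ E) (a : F) (L : E →L[ℝ] F) :
    ∫ ε, ‖a + L ε‖ ^ 2 ∂(stdGaussian E) = ‖a‖ ^ 2 + ∑ i, ‖L (b i)‖ ^ 2 := by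
  let c := stdOrthonormalBasis ℝ F
  have hcoord (ε : E) : ‖a + L ε‖ ^ 2 =
      ∑ j, (inner ℝ (c j) a + inner ℝ (ContinuousLinearMap.adjoint L (c j)) ε) ^ 2 := by
    simp only [← c.sum_sq_inner_right (a + L ε), inner_add_right,
      ContinuousLinearMap.adjoint_inner_left]
  have hadj : ∑ j, ‖ContinuousLinearMap.adjoint L (c j)‖ ^ 2 = ∑ i, ‖L (b i)‖ ^ 2 := by
    simp_rw [← b.sum_sq_inner_left, ← c.sum_sq_inner_right (L _),
      ContinuousLinearMap.adjoint_inner_left]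
    exact Finset.sum_comm
  simp_rw [hcoord, integral_finsetSum _ fun _ _ => (memLp_add_inner_stdGaussian _ _).integrable_sq,
    integral_add_inner_sq_stdGaussian, Finset.sum_add_distrib, hadj, c.sum_sq_inner_right]

end GaussianMoments

/-! ### Operators diagonal in an orthonormal basis -/

section DiagonalOp

variable {ι E : Type*} [Fintype ι] [NormedAddCommGroup E] [InnerProductSpace ℝ E]
  [FiniteDimensional ℝ E]

/-- The operator with eigenvectors `b i` and eigenvalues `f i`, as an algebra homomorphism in `f`,
so that polynomials of eigenvalues correspond to polynomials of operators. -/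
def diagonalOp (b : OrthonormalBasis ι ℝ E) : (ι → ℝ) →ₐ[ℝ] E →L[ℝ] E := by
  classical
  exact (Module.End.toContinuousLinearMap E).toAlgHom.comp
    ((Matrix.toLinAlgEquiv b.toBasis).toAlgHom.comp (Matrix.diagonalAlgHom ℝ))

variable (b : OrthonormalBasis ι ℝ E) (f : ι → ℝ)

lemma diagonalOp_apply_self (i : ι) : diagonalOp b f (b i) = f i • b i := by
  classical
  have h := Matrix.toLinAlgEquiv_self b.toBasis (Matrix.diagonal f) i
  rw [b.coe_toBasis] at h
  exact h.trans (by simp [Matrix.diagonal_apply, ite_smul])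

lemma diagonalOp_apply (v : E) : diagonalOp b f v = ∑ i, (f i * inner ℝ (b i) v) • b i := by
  conv_lhs => rw [← b.sum_repr' v, map_sum]
  simp_rw [map_smul, diagonalOp_apply_self, smul_smul, mul_comm]

lemma inner_diagonalOp (v : E) (i : ι) :
    inner ℝ (b i) (diagonalOp b f v) = f i * inner ℝ (b i) v := by
  classical
  simp_rw [diagonalOp_apply, inner_sum, inner_smul_right, b.inner_eq_ite]
  simp

lemma inner_diagonalOp_self (v : E) :
    inner ℝ v (diagonalOp b f v) = ∑ i, f i * inner ℝ (b i) v ^ 2 := by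
  simp_rw [diagonalOp_apply, inner_sum, inner_smul_right, real_inner_comm (b _), sq, mul_assoc]

lemma trace_diagonalOp :
    LinearMap.trace ℝ E (diagonalOp b f : E →L[ℝ] E) = ∑ i, f i := by
  rw [LinearMap.trace_eq_sum_inner _ b]
  simp [diagonalOp_apply_self, real_inner_smul_right]

lemma tendsto_diagonalOp {α : Type*} {l : Filter α} {g : α → ι → ℝ}
    (h : ∀ i, Tendsto (fun a => g a i) l (nhds (f i))) :
    Tendsto (fun a => diagonalOp b (g a)) l (nhds (diagonalOp b f)) :=
  ((diagonalOp b).toLinearMap.continuous_of_finiteDimensional.tendsto f).comp (tendsto_pi_nhds.2 h)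

lemma sum_le_sum_inner_of_concaveOn {κ : Type*} [Fintype κ] {s : Set ℝ} {φ : ℝ → ℝ}
    (hφ : ConcaveOn ℝ s φ) (hf : ∀ i, f i ∈ s) (c : OrthonormalBasis κ ℝ E) :
    ∑ i, φ (f i) ≤ ∑ j, φ (inner ℝ (c j) (diagonalOp b f (c j))) := by
  have hjensen (j : κ) : ∑ i, inner ℝ (b i) (c j) ^ 2 • φ (f i) ≤
      φ (inner ℝ (c j) (diagonalOp b f (c j))) := by
    simp_rw [inner_diagonalOp_self, mul_comm (f _), ← smul_eq_mul (_ ^ 2)]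
    exact hφ.le_map_sum (fun i _ => sq_nonneg _)
      (by rw [b.sum_sq_inner_right, c.norm_eq_one, one_pow]) fun i _ => hf i
  calc ∑ i, φ (f i) = ∑ j, ∑ i, inner ℝ (b i) (c j) ^ 2 • φ (f i) := by
        rw [Finset.sum_comm]
        simp_rw [← Finset.sum_smul, c.sum_sq_inner_left, b.norm_eq_one, one_pow, one_smul]
    _ ≤ _ := Finset.sum_le_sum fun j _ => hjensen j

end DiagonalOp

/-! ### Sample mean and covariance -/

section SampleCovariance

variable {ι E F : Type*} [Fintype ι] [NormedAddCommGroup E] [InnerProductSpace ℝ E]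
  [NormedAddCommGroup F] [InnerProductSpace ℝ F]

/-- The mean of the points `x i`; it is `0` if there are none. -/
def sampleMean (x : ι → E) : E := (Fintype.card ι : ℝ)⁻¹ • ∑ i, x i

lemma sampleMean_comp (L : E →L[ℝ] F) (x : ι → E) :
    sampleMean (fun i => L (x i)) = L (sampleMean x) := by
  simp [sampleMean]

@[fun_prop]
lemma continuous_sampleMean : Continuous (sampleMean : (ι → E) → E) := by
  unfold sampleMean
  fun_prop

variable (ι E) in
/-- The sample mean as a continuous linear map. -/
def sampleMeanL : (ι → E) →L[ℝ] E :=
  (Fintype.card ι : ℝ)⁻¹ • ∑ i, ContinuousLinearMap.proj i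

lemma sampleMeanL_apply (x : ι → E) : sampleMeanL ι E x = sampleMean x := by
  simp [sampleMeanL, sampleMean]

lemma inner_sampleMean (a : E) (x : ι → E) :
    inner ℝ a (sampleMean x) = (Fintype.card ι : ℝ)⁻¹ * ∑ i, inner ℝ a (x i) := by
  rw [sampleMean, inner_smul_right, inner_sum]

lemma card_smul_sampleMean [Nonempty ι] (x : ι → E) :
    (Fintype.card ι : ℝ) • sampleMean x = ∑ i, x i :=
  smul_inv_smul₀ (Nat.cast_ne_zero.2 Fintype.card_ne_zero) _

lemma sum_inner_eq_card_mul [Nonempty ι] (x : ι → E) (v : E) :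
    ∑ i, inner ℝ (x i) v = Fintype.card ι * inner ℝ (sampleMean x) v := by
  rw [← sum_inner, ← card_smul_sampleMean, real_inner_smul_left]

lemma sum_inner_sub_sampleMean_sq [Nonempty ι] (x : ι → E) (v : E) :
    (Fintype.card ι : ℝ)⁻¹ * ∑ i, inner ℝ (x i - sampleMean x) v ^ 2 =
      (Fintype.card ι : ℝ)⁻¹ * ∑ i, inner ℝ (x i) v ^ 2 - inner ℝ (sampleMean x) v ^ 2 := by
  have hι : (Fintype.card ι : ℝ) ≠ 0 := Nat.cast_ne_zero.2 Fintype.card_ne_zero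
  simp_rw [inner_sub_left, sub_sq, Finset.sum_add_distrib, Finset.sum_sub_distrib,
    ← Finset.sum_mul, ← Finset.mul_sum, sum_inner_eq_card_mul, Finset.sum_const, Finset.card_univ,
    nsmul_eq_mul]
  field_simp
  ring

/-- The second moment operator of the points `x i` about the origin, minus the fraction `1 - ρ` of
the one of their mean. It is the sample covariance operator for `ρ = 0`. -/
def covOp (ρ : ℝ) (x : ι → E) : E →L[ℝ] E :=
  (Fintype.card ι : ℝ)⁻¹ • ∑ i, (innerSL ℝ (x i)).smulRight (x i) -
    (1 - ρ) • (innerSL ℝ (sampleMean x)).smulRight (sampleMean x)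

lemma continuous_covOp (ρ : ℝ) : Continuous fun x : ι → E => covOp ρ x := by
  unfold covOp
  fun_prop

lemma inner_covOp (ρ : ℝ) (x : ι → E) (v w : E) :
    inner ℝ v (covOp ρ x w) =
      (Fintype.card ι : ℝ)⁻¹ * ∑ i, inner ℝ v (x i) * inner ℝ w (x i) -
        (1 - ρ) * (inner ℝ v (sampleMean x) * inner ℝ w (sampleMean x)) := by
  simp [covOp, inner_sub_right, inner_smul_right, inner_sum, real_inner_comm w, mul_comm]

lemma covOp_isSymmetric (ρ : ℝ) (x : ι → E) : (covOp ρ x : E →ₗ[ℝ] E).IsSymmetric := by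
  intro v w
  rw [ContinuousLinearMap.coe_coe, real_inner_comm, inner_covOp, inner_covOp]
  simp_rw [mul_comm]

lemma inner_covOp_self [Nonempty ι] (ρ : ℝ) (x : ι → E) (v : E) :
    inner ℝ v (covOp ρ x v) =
      (Fintype.card ι : ℝ)⁻¹ * ∑ i, inner ℝ (x i - sampleMean x) v ^ 2 +
        ρ * inner ℝ (sampleMean x) v ^ 2 := by
  rw [sum_inner_sub_sampleMean_sq, inner_covOp]
  simp_rw [← sq, real_inner_comm v]
  ring

variable [FiniteDimensional ℝ E]

/-- The eigenvalues of `covOp`. -/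
def covEig (ρ : ℝ) (x : ι → E) : Fin (Module.finrank ℝ E) → ℝ :=
  (covOp_isSymmetric ρ x).eigenvalues rfl

/-- An orthonormal basis of eigenvectors of `covOp`. -/
def covBasis (ρ : ℝ) (x : ι → E) : OrthonormalBasis (Fin (Module.finrank ℝ E)) ℝ E :=
  (covOp_isSymmetric ρ x).eigenvectorBasis rfl

lemma covOp_covBasis (ρ : ℝ) (x : ι → E) (j : Fin (Module.finrank ℝ E)) :
    covOp ρ x (covBasis ρ x j) = covEig ρ x j • covBasis ρ x j :=
  (covOp_isSymmetric ρ x).apply_eigenvectorBasis rfl j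

lemma inner_covBasis_covOp (ρ : ℝ) (x : ι → E) (j : Fin (Module.finrank ℝ E)) :
    inner ℝ (covBasis ρ x j) (covOp ρ x (covBasis ρ x j)) = covEig ρ x j := by
  simp [covOp_covBasis, inner_smul_right]

lemma covOp_eq_diagonalOp (ρ : ℝ) (x : ι → E) :
    covOp ρ x = diagonalOp (covBasis ρ x) (covEig ρ x) :=
  ContinuousLinearMap.coe_injective <| (covBasis ρ x).toBasis.ext fun j => by
    simp [covOp_covBasis, diagonalOp_apply_self]

lemma covEig_nonneg [Nonempty ι] {ρ : ℝ} (hρ : 0 ≤ ρ) (x : ι → E)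
    (j : Fin (Module.finrank ℝ E)) : 0 ≤ covEig ρ x j := by
  rw [← inner_covBasis_covOp, inner_covOp_self]
  positivity

lemma sum_covEig_mul_norm_sq (ρ : ℝ) (x : ι → E) (L : E →L[ℝ] F) :
    ∑ j, covEig ρ x j * ‖L (covBasis ρ x j)‖ ^ 2 =
      (Fintype.card ι : ℝ)⁻¹ * ∑ i, ‖L (x i)‖ ^ 2 - (1 - ρ) * ‖L (sampleMean x)‖ ^ 2 := by
  let u := covBasis ρ x
  have hrankOne (y : E) : ‖L y‖ ^ 2 = ∑ j, inner ℝ y (u j) * inner ℝ (L y) (L (u j)) := by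
    have hy : L y = ∑ j, inner ℝ (u j) y • L (u j) := by
      simp_rw [← map_smul, ← map_sum, u.sum_repr']
    calc ‖L y‖ ^ 2 = inner ℝ (L y) (∑ j, inner ℝ (u j) y • L (u j)) := by
          rw [← hy, real_inner_self_eq_norm_sq]
      _ = _ := by simp_rw [inner_sum, inner_smul_right, real_inner_comm y]
  have hcov (j : Fin (Module.finrank ℝ E)) : covEig ρ x j * ‖L (u j)‖ ^ 2 =
      (Fintype.card ι : ℝ)⁻¹ * ∑ i, inner ℝ (x i) (u j) * inner ℝ (L (x i)) (L (u j)) -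
        (1 - ρ) * (inner ℝ (sampleMean x) (u j) * inner ℝ (L (sampleMean x)) (L (u j))) := by
    rw [← real_inner_self_eq_norm_sq, ← real_inner_smul_left, ← map_smul, ← covOp_covBasis]
    simp [covOp, inner_sub_left, real_inner_smul_left, sum_inner, u]
  simp only [u] at hrankOne hcov
  simp_rw [hcov, Finset.sum_sub_distrib, hrankOne, ← Finset.mul_sum]
  rw [Finset.sum_comm]

end SampleCovariance

/-! ### Training -/

lemma exp_neg_two_mul_lt_one {t : ℝ} (ht : 0 < t) : Real.exp (-2 * t) < 1 :=
  Real.exp_lt_one_iff.2 (by linarith)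

lemma signal_sq (t : ℝ) : signal t ^ 2 = Real.exp (-2 * t) := by
  rw [signal, ← Real.exp_nat_mul]
  ring_nf

lemma noise_sq {t : ℝ} (ht : 0 < t) : noise t ^ 2 = 1 - Real.exp (-2 * t) :=
  Real.sq_sqrt (sub_nonneg.2 (exp_neg_two_mul_lt_one ht).le)

lemma noise_pos {t : ℝ} (ht : 0 < t) : 0 < noise t :=
  Real.sqrt_pos.2 (sub_pos.2 (exp_neg_two_mul_lt_one ht))

/-- The variance at time `t` of the forward process whose initial variance is `l`. -/
def forwardVar (t l : ℝ) : ℝ := Real.exp (-2 * t) * l + (1 - Real.exp (-2 * t))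

lemma forwardVar_pos {t l : ℝ} (ht : 0 < t) (hl : 0 ≤ l) : 0 < forwardVar t l :=
  add_pos_of_nonneg_of_pos (mul_nonneg (Real.exp_pos _).le hl)
    (sub_pos.2 (exp_neg_two_mul_lt_one ht))

/-- The factor by which training with corruption level `γ` shrinks the sample mean is
`1 - shrinkage γ`. -/
def shrinkage (γ : ℝ) : ℝ := γ ^ 2 / (1 + γ ^ 2)

lemma shrinkage_nonneg (γ : ℝ) : 0 ≤ shrinkage γ := by
  unfold shrinkage
  positivity

lemma shrinkage_zero : shrinkage 0 = 0 := by simp [shrinkage]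

lemma one_sub_shrinkage_mul (γ : ℝ) : (1 - shrinkage γ) * (1 + γ ^ 2) = 1 := by
  unfold shrinkage
  field_simp
  ring

section CompletingTheSquare

variable {ι E : Type*} [Fintype ι] [NormedAddCommGroup E] [InnerProductSpace ℝ E]

lemma mean_norm_smul_add_sq [Nonempty ι] (γ s : ℝ) (y : ι → E) (v : E) :
    (Fintype.card ι : ℝ)⁻¹ * ∑ i, ‖s • y i + v‖ ^ 2 + γ ^ 2 * ‖v‖ ^ 2 =
      (1 + γ ^ 2) * ‖v + (s * (1 - shrinkage γ)) • sampleMean y‖ ^ 2 +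
        s ^ 2 * ((Fintype.card ι : ℝ)⁻¹ * ∑ i, ‖y i‖ ^ 2 -
          (1 - shrinkage γ) * ‖sampleMean y‖ ^ 2) := by
  have hι : (Fintype.card ι : ℝ) ≠ 0 := Nat.cast_ne_zero.2 Fintype.card_ne_zero
  have hexpand : (Fintype.card ι : ℝ)⁻¹ * ∑ i, ‖s • y i + v‖ ^ 2 =
      s ^ 2 * ((Fintype.card ι : ℝ)⁻¹ * ∑ i, ‖y i‖ ^ 2) + 2 * s * inner ℝ (sampleMean y) v +
        ‖v‖ ^ 2 := by
    simp_rw [norm_add_sq_real, norm_smul, mul_pow, real_inner_smul_left, Finset.sum_add_distrib,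
      ← Finset.mul_sum, sum_inner_eq_card_mul, Finset.sum_const, Finset.card_univ, nsmul_eq_mul,
      Real.norm_eq_abs, sq_abs]
    field_simp
  rw [hexpand, norm_add_sq_real, inner_smul_right, norm_smul, mul_pow, Real.norm_eq_abs, sq_abs,
    real_inner_comm (sampleMean y)]
  linear_combination (-2 * s * inner ℝ (sampleMean y) v -
    s ^ 2 * (1 - shrinkage γ) * ‖sampleMean y‖ ^ 2) * one_sub_shrinkage_mul γ

lemma sq_mul_norm_add_norm_smul_sub {a σ F : ℝ} (hF : F ≠ 0) (ha : a + σ ^ 2 = F) (w u : E) :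
    a * ‖w‖ ^ 2 + ‖σ • w - u‖ ^ 2 =
      F * ‖w - (σ / F) • u‖ ^ 2 + (1 - σ ^ 2 / F) * ‖u‖ ^ 2 := by
  simp_rw [norm_sub_sq_real, norm_smul, mul_pow, real_inner_smul_left, inner_smul_right,
    Real.norm_eq_abs, sq_abs]
  field_simp
  linear_combination F * ‖w‖ ^ 2 * ha

end CompletingTheSquare

section ClassLoss

variable {ι κ E F : Type*} [Fintype ι] [Fintype κ]
  [NormedAddCommGroup E] [InnerProductSpace ℝ E] [FiniteDimensional ℝ E]
  [NormedAddCommGroup F] [InnerProductSpace ℝ F]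

section Defs

variable [FiniteDimensional ℝ F] [MeasurableSpace E] [BorelSpace E] [MeasurableSpace F]
  [BorelSpace F]

/-- The denoising loss at time `t` of the affine network `W x + V c` on the points `x i` of a single
class whose label is encoded by `c`. -/
def classLoss (x : ι → E) (c : F) (γ t : ℝ) (W : E →L[ℝ] E) (V : F →L[ℝ] E) : ℝ :=
  (Fintype.card ι : ℝ)⁻¹ * ∑ i, ∫ ξ, ∫ ε,
    ‖W (signal t • x i + noise t • ε) + V (c + γ • ξ) - ε‖ ^ 2 ∂(stdGaussian E) ∂(stdGaussian F)

lemma integral_norm_denoise_sq {ι' : Type*} [Fintype ι'] (u : OrthonormalBasis ι' ℝ E)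
    (b : OrthonormalBasis κ ℝ F) (s σ γ : ℝ) (x : E) (c : F) (W : E →L[ℝ] E) (V : F →L[ℝ] E) :
    ∫ ξ, ∫ ε, ‖W (s • x + σ • ε) + V (c + γ • ξ) - ε‖ ^ 2 ∂(stdGaussian E) ∂(stdGaussian F) =
      ‖s • W x + V c‖ ^ 2 + γ ^ 2 * ∑ l, ‖V (b l)‖ ^ 2 + ∑ j, ‖σ • W (u j) - u j‖ ^ 2 := by
  have hε (ξ : F) : ∫ ε, ‖W (s • x + σ • ε) + V (c + γ • ξ) - ε‖ ^ 2 ∂(stdGaussian E) =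
      ‖(s • W x + V c) + (γ • V) ξ‖ ^ 2 + ∑ j, ‖σ • W (u j) - u j‖ ^ 2 := by
    have h := integral_norm_add_apply_sq_stdGaussian u ((s • W x + V c) + (γ • V) ξ)
      (σ • W - ContinuousLinearMap.id ℝ E)
    simp only [sub_apply, smul_apply, ContinuousLinearMap.id_apply] at h
    rw [smul_apply, ← h]
    congr with ε
    congr 2
    simp only [map_add, map_smul]
    abel
  simp_rw [hε]
  rw [integral_add (integrable_norm_add_apply_sq_stdGaussian _ _) (integrable_const _),
    integral_norm_add_apply_sq_stdGaussian b]
  simp [norm_smul, mul_pow, Finset.mul_sum]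

end Defs

/-- The optimal matrix acting on the noisy data point. -/
def optW (γ t : ℝ) (x : ι → E) : E →L[ℝ] E :=
  diagonalOp (covBasis (shrinkage γ) x) fun j => noise t / forwardVar t (covEig (shrinkage γ) x j)

/-- The optimal matrix acting on the label embedding, for a class with label encoding `c`. -/
def optV (γ t : ℝ) (c : F) (x : ι → E) : F →L[ℝ] E :=
  (innerSL ℝ c).smulRight (-(signal t * (1 - shrinkage γ)) • optW γ t x (sampleMean x))

lemma optV_self (γ t : ℝ) (b : OrthonormalBasis κ ℝ F) (k : κ) (x : ι → E) :
    optV γ t (b k) x (b k) = -(signal t * (1 - shrinkage γ)) • optW γ t x (sampleMean x) := by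
  simp [optV]

variable [FiniteDimensional ℝ F] [MeasurableSpace E] [BorelSpace E] [MeasurableSpace F]
  [BorelSpace F]

lemma classLoss_eq [Nonempty ι] [DecidableEq κ] (γ : ℝ) {t : ℝ} (ht : 0 < t)
    (b : OrthonormalBasis κ ℝ F) (k : κ) (x : ι → E) (W : E →L[ℝ] E) (V : F →L[ℝ] E) :
    classLoss x (b k) γ t W V =
      (1 + γ ^ 2) * ‖V (b k) + (signal t * (1 - shrinkage γ)) • W (sampleMean x)‖ ^ 2 +
      γ ^ 2 * ∑ l ∈ Finset.univ.erase k, ‖V (b l)‖ ^ 2 +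
      ∑ j, forwardVar t (covEig (shrinkage γ) x j) *
        ‖W (covBasis (shrinkage γ) x j) - optW γ t x (covBasis (shrinkage γ) x j)‖ ^ 2 +
      ∑ j, (1 - noise t ^ 2 / forwardVar t (covEig (shrinkage γ) x j)) := by
  set u := covBasis (shrinkage γ) x
  set l := covEig (shrinkage γ) x
  have hι : (Fintype.card ι : ℝ) ≠ 0 := Nat.cast_ne_zero.2 Fintype.card_ne_zero
  have hfv (j) : forwardVar t (l j) ≠ 0 :=
    (forwardVar_pos ht (covEig_nonneg (shrinkage_nonneg γ) x j)).ne'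
  have hdir (j) : signal t ^ 2 * (l j * ‖W (u j)‖ ^ 2) + ‖noise t • W (u j) - u j‖ ^ 2 =
      forwardVar t (l j) * ‖W (u j) - optW γ t x (u j)‖ ^ 2 +
        (1 - noise t ^ 2 / forwardVar t (l j)) := by
    rw [← mul_assoc, sq_mul_norm_add_norm_smul_sub (hfv j)
      (by rw [forwardVar, noise_sq ht, signal_sq]), optW, diagonalOp_apply_self, u.norm_eq_one,
      one_pow, mul_one]
  have hmean := mean_norm_smul_add_sq γ (signal t) (fun i => W (x i)) (V (b k))
  rw [sampleMean_comp, ← sum_covEig_mul_norm_sq] at hmean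
  have hloss : classLoss x (b k) γ t W V =
      (Fintype.card ι : ℝ)⁻¹ * ∑ i, ‖signal t • W (x i) + V (b k)‖ ^ 2 + γ ^ 2 * ‖V (b k)‖ ^ 2 +
        γ ^ 2 * ∑ l ∈ Finset.univ.erase k, ‖V (b l)‖ ^ 2 +
        ∑ j, ‖noise t • W (u j) - u j‖ ^ 2 := by
    simp_rw [classLoss, integral_norm_denoise_sq u b, Finset.sum_add_distrib,
      ← Finset.add_sum_erase _ _ (Finset.mem_univ k), Finset.sum_const, Finset.card_univ,
      nsmul_eq_mul]
    field_simp
    ring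
  rw [hloss, hmean]
  simp_rw [add_assoc, ← Finset.sum_add_distrib, ← hdir, Finset.sum_add_distrib, Finset.mul_sum]
  ring

/-- The minimum of the denoising loss of a single class. -/
def minClassLoss (γ t : ℝ) (x : ι → E) : ℝ :=
  ∑ j, (1 - noise t ^ 2 / forwardVar t (covEig (shrinkage γ) x j))

lemma minClassLoss_le_classLoss [Nonempty ι] (γ : ℝ) {t : ℝ} (ht : 0 < t)
    (b : OrthonormalBasis κ ℝ F) (k : κ) (x : ι → E) (W : E →L[ℝ] E) (V : F →L[ℝ] E) :
    minClassLoss γ t x ≤ classLoss x (b k) γ t W V := by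
  classical
  have hfv (j) := forwardVar_pos ht (covEig_nonneg (shrinkage_nonneg γ) x j)
  rw [classLoss_eq γ ht]
  exact le_add_of_nonneg_left (add_nonneg (by positivity)
    (Finset.sum_nonneg fun j _ => mul_nonneg (hfv j).le (sq_nonneg _)))

lemma classLoss_opt [Nonempty ι] (γ : ℝ) {t : ℝ} (ht : 0 < t)
    (b : OrthonormalBasis κ ℝ F) (k : κ) (x : ι → E) :
    classLoss x (b k) γ t (optW γ t x) (optV γ t (b k) x) = minClassLoss γ t x := by
  classical
  have hV : ∀ l ∈ Finset.univ.erase k, ‖optV γ t (b k) x (b l)‖ ^ 2 = 0 := fun l hl => by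
    simp [optV, b.inner_eq_zero (Finset.ne_of_mem_erase hl).symm]
  rw [classLoss_eq γ ht, Finset.sum_eq_zero hV, optV_self]
  simp [minClassLoss]

lemma classLoss_opt_le (γ : ℝ) {t : ℝ} (ht : 0 < t) (b : OrthonormalBasis κ ℝ F) (k : κ)
    (x : ι → E) (W : E →L[ℝ] E) (V : F →L[ℝ] E) :
    classLoss x (b k) γ t (optW γ t x) (optV γ t (b k) x) ≤ classLoss x (b k) γ t W V := by
  cases isEmpty_or_nonempty ι
  · simp [classLoss]
  · rw [classLoss_opt γ ht]
    exact minClassLoss_le_classLoss γ ht b k x W V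

lemma eq_opt_of_classLoss_le [Nonempty ι] {γ t : ℝ} (ht : 0 < t) {b : OrthonormalBasis κ ℝ F}
    {k : κ} {x : ι → E} {W : E →L[ℝ] E} {V : F →L[ℝ] E}
    (h : classLoss x (b k) γ t W V ≤ minClassLoss γ t x) :
    W = optW γ t x ∧ V (b k) = optV γ t (b k) x (b k) := by
  classical
  have hfv (j) := forwardVar_pos ht (covEig_nonneg (shrinkage_nonneg γ) x j)
  have hnonneg (j) : 0 ≤ forwardVar t (covEig (shrinkage γ) x j) *
      ‖W (covBasis (shrinkage γ) x j) - optW γ t x (covBasis (shrinkage γ) x j)‖ ^ 2 :=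
    mul_nonneg (hfv j).le (sq_nonneg _)
  have hsum := Finset.sum_nonneg fun j (_ : j ∈ Finset.univ) => hnonneg j
  have hrest : 0 ≤ γ ^ 2 * ∑ l ∈ Finset.univ.erase k, ‖V (b l)‖ ^ 2 := by positivity
  have hbias : 0 ≤ (1 + γ ^ 2) *
    ‖V (b k) + (signal t * (1 - shrinkage γ)) • W (sampleMean x)‖ ^ 2 := by positivity
  rw [classLoss_eq γ ht, ← minClassLoss] at h
  have hW : W = optW γ t x := by
    refine ContinuousLinearMap.coe_injective ((covBasis (shrinkage γ) x).toBasis.ext fun j => ?_)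
    have hj := (Finset.sum_eq_zero_iff_of_nonneg fun j _ => hnonneg j).1
      (le_antisymm (by linarith) hsum) j (Finset.mem_univ j)
    simpa [(hfv j).ne', sub_eq_zero] using hj
  have hV : ‖V (b k) + (signal t * (1 - shrinkage γ)) • W (sampleMean x)‖ ^ 2 = 0 :=
    (mul_eq_zero.1 (le_antisymm (by linarith) hbias)).resolve_left (by positivity)
  refine ⟨hW, ?_⟩
  rw [optV_self, neg_smul, ← hW]
  exact eq_neg_of_add_eq_zero_left (norm_eq_zero.1 (sq_eq_zero_iff.1 hV))

end ClassLoss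

section TrainedNetwork

variable {K d : ℕ} {n : Fin K → ℕ}

lemma LinearDenoiser.eval_eq (θ : LinearDenoiser K d) (x : Euc d) (k : Fin K) (c : Euc K) :
    θ.eval x k c = θ.W k x + θ.V k c := by
  simp [LinearDenoiser.eval]

lemma trainingLoss_eq (w : Fin K → ℝ) (X : Dataset n d) (γ t : ℝ) (θ : LinearDenoiser K d) :
    trainingLoss w X γ t θ = ∑ k, w k * classLoss (X k) (oneHot k) γ t (θ.W k) (θ.V k) := by
  simp_rw [trainingLoss, classLoss, LinearDenoiser.eval_eq, Fintype.card_fin, div_eq_mul_inv,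
    mul_assoc]

lemma oneHot_eq (k : Fin K) : oneHot k = EuclideanSpace.basisFun (Fin K) ℝ k := by
  simp [oneHot]

/-- The parameters at time `t` of a network trained to optimality. -/
def optDenoiser (γ t : ℝ) (X : Dataset n d) : LinearDenoiser K d where
  W k := optW γ t (X k)
  V k := optV γ t (oneHot k) (X k)

lemma optDenoiser_loss_le {w : Fin K → ℝ} (hw : ∀ k, 0 < w k) (X : Dataset n d) (γ : ℝ) {t : ℝ}
    (ht : 0 < t) (θ : LinearDenoiser K d) (k : Fin K) :
    w k * classLoss (X k) (oneHot k) γ t ((optDenoiser γ t X).W k) ((optDenoiser γ t X).V k) ≤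
      w k * classLoss (X k) (oneHot k) γ t (θ.W k) (θ.V k) := by
  have h := classLoss_opt_le γ ht (EuclideanSpace.basisFun (Fin K) ℝ) k (X k) (θ.W k) (θ.V k)
  rw [← oneHot_eq] at h
  exact mul_le_mul_of_nonneg_left h (hw k).le

lemma isTrained_optDenoiser {w : Fin K → ℝ} (hw : ∀ k, 0 < w k) (X : Dataset n d) (γ : ℝ) :
    IsTrained w X γ fun t => optDenoiser γ t X := by
  intro t ht θ
  simp_rw [trainingLoss_eq]
  exact Finset.sum_le_sum fun k _ => optDenoiser_loss_le hw X γ ht θ k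

lemma IsTrained.eq_opt {w : Fin K → ℝ} (hw : ∀ k, 0 < w k) {X : Dataset n d} {γ : ℝ}
    {θ : ℝ → LinearDenoiser K d} (h : IsTrained w X γ θ) {t : ℝ} (ht : 0 < t) (k : Fin K)
    [NeZero (n k)] :
    (θ t).W k = optW γ t (X k) ∧
      (θ t).V k (oneHot k) =
        -(signal t * (1 - shrinkage γ)) • optW γ t (X k) (sampleMean (X k)) := by
  have hle := h t ht (optDenoiser γ t X)
  simp_rw [trainingLoss_eq] at hle
  have heq := (Finset.sum_eq_sum_iff_of_le fun k _ => optDenoiser_loss_le hw X γ ht (θ t) k).1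
    (le_antisymm (Finset.sum_le_sum fun k _ => optDenoiser_loss_le hw X γ ht (θ t) k) hle) k
    (Finset.mem_univ k)
  have hk := (mul_left_cancel₀ (hw k).ne' heq).ge
  simp only [optDenoiser, oneHot_eq, classLoss_opt γ ht] at hk ⊢
  rw [← optV_self γ t (EuclideanSpace.basisFun (Fin K) ℝ) k]
  exact eq_opt_of_classLoss_le ht hk

lemma IsTrained.scoreEstimate_eq {w : Fin K → ℝ} (hw : ∀ k, 0 < w k) {X : Dataset n d} {γ : ℝ}
    {θ : ℝ → LinearDenoiser K d} (h : IsTrained w X γ θ) {t : ℝ} (ht : 0 < t) (k : Fin K)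
    [NeZero (n k)] (z : Euc d) :
    scoreEstimate θ k t z =
      -diagonalOp (covBasis (shrinkage γ) (X k))
        (fun j => (forwardVar t (covEig (shrinkage γ) (X k) j))⁻¹)
        (z - (signal t * (1 - shrinkage γ)) • sampleMean (X k)) := by
  obtain ⟨hW, hV⟩ := h.eq_opt hw ht k
  have hcoef : (fun j => noise t / forwardVar t (covEig (shrinkage γ) (X k) j)) =
      noise t • fun j => (forwardVar t (covEig (shrinkage γ) (X k) j))⁻¹ := by
    ext j
    simp [div_eq_mul_inv]
  rw [scoreEstimate, LinearDenoiser.eval_eq, hW, hV, neg_smul, ← sub_eq_add_neg, ← map_smul,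
    ← map_sub, optW, hcoef, map_smul, smul_apply, inv_smul_smul₀ (noise_pos ht).ne']

end TrainedNetwork

/-! ### The reverse flow -/

lemma forwardVar_zero (l : ℝ) : forwardVar 0 l = l := by simp [forwardVar]

lemma signal_zero : signal 0 = 1 := by simp [signal]

lemma continuous_forwardVar_sub (T l : ℝ) : Continuous fun s => forwardVar (T - s) l := by
  unfold forwardVar
  fun_prop

lemma hasDerivAt_signal_sub (T s : ℝ) :
    HasDerivAt (fun s => signal (T - s)) (signal (T - s)) s := by
  simpa [signal, Function.comp_def] using (((hasDerivAt_id s).const_sub T).neg).exp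

lemma hasDerivAt_forwardVar_sub (T l s : ℝ) :
    HasDerivAt (fun s => forwardVar (T - s) l) (2 * (forwardVar (T - s) l - 1)) s := by
  have hlin : HasDerivAt (fun s : ℝ => -2 * (T - s)) 2 s := by
    simpa using ((hasDerivAt_id s).const_sub T).const_mul (-2)
  refine ((hlin.exp.mul_const l).add (hlin.exp.const_sub 1)).congr_deriv ?_
  unfold forwardVar
  ring

lemma hasDerivAt_sqrt_forwardVar_sub {T l s : ℝ} (hs : s < T) (hl : 0 ≤ l) :
    HasDerivAt (fun s => √(forwardVar (T - s) l))
      ((1 - (forwardVar (T - s) l)⁻¹) * √(forwardVar (T - s) l)) s := by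
  have hv := forwardVar_pos (sub_pos.2 hs) hl
  refine ((hasDerivAt_forwardVar_sub T l s).sqrt hv.ne').congr_deriv ?_
  have hsq := Real.sq_sqrt hv.le
  field_simp
  rw [hsq]
  ring

lemma eq_div_mul_of_hasDerivWithinAt {a y g : ℝ → ℝ} {T : ℝ} (hT : 0 < T)
    (hy : ContinuousOn y (Set.Icc 0 T)) (hg : ContinuousOn g (Set.Icc 0 T))
    (hy' : ∀ s ∈ Set.Ico 0 T, HasDerivWithinAt y (a s * y s) (Set.Icc 0 T) s)
    (hg' : ∀ s ∈ Set.Ico 0 T, HasDerivWithinAt g (a s * g s) (Set.Icc 0 T) s)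
    (hg0 : ∀ s ∈ Set.Ico 0 T, g s ≠ 0) : y T = g T / g 0 * y 0 := by
  have hratio : ∀ b ∈ Set.Ico 0 T, y b / g b = y 0 / g 0 := by
    intro b hb
    have hsub : Set.Icc 0 b ⊆ Set.Icc 0 T := Set.Icc_subset_Icc_right hb.2.le
    refine constant_of_has_deriv_right_zero (f := fun s => y s / g s)
      ((hy.mono hsub).div (hg.mono hsub) fun s hs => hg0 s ⟨hs.1, hs.2.trans_lt hb.2⟩)
      (fun s hs => ?_) b ⟨hb.1, le_rfl⟩
    have hsT : s ∈ Set.Ico 0 T := ⟨hs.1, hs.2.trans hb.2⟩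
    have hquot := ((hy' s hsT).div (hg' s hsT) (hg0 s hsT)).congr_deriv
      (g' := 0) (by ring)
    exact (hquot.mono (Set.Icc_subset_Icc_left hs.1)).mono_of_mem_nhdsWithin
      (Icc_mem_nhdsGE hsT.2)
  have heq : Set.EqOn y (fun s => g s / g 0 * y 0) (Set.Ico 0 T) := fun s hs => by
    have h := hratio s hs
    have h0 := hg0 0 ⟨le_rfl, hT⟩
    have hs0 := hg0 s hs
    field_simp at h ⊢
    linarith
  exact heq.of_subset_closure hy ((hg.div_const _).mul_const _) Set.Ico_subset_Icc_self
    (closure_Ico hT.ne).ge ⟨hT.le, le_rfl⟩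

section Flow

variable {ι E : Type*} [Fintype ι] [NormedAddCommGroup E] [InnerProductSpace ℝ E]
  [FiniteDimensional ℝ E]

/-- The velocity field at time `s` of the reverse equation with the score estimate of a trained
network. -/
def reverseDrift (ρ T : ℝ) (x : ι → E) (s : ℝ) (z : E) : E :=
  z - diagonalOp (covBasis ρ x) (fun j => (forwardVar (T - s) (covEig ρ x j))⁻¹)
    (z - (signal (T - s) * (1 - ρ)) • sampleMean x)

/-- The explicit solution of the reverse equation. -/
def reverseFlow (ρ T : ℝ) (x : ι → E) (s : ℝ) (z : E) : E :=
  (signal (T - s) * (1 - ρ)) • sampleMean x +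
    diagonalOp (covBasis ρ x)
      (fun j => √(forwardVar (T - s) (covEig ρ x j)) / √(forwardVar T (covEig ρ x j)))
      (z - (signal T * (1 - ρ)) • sampleMean x)

lemma reverseFlow_zero [Nonempty ι] {ρ T : ℝ} (hρ : 0 ≤ ρ) (hT : 0 < T) (x : ι → E) (z : E) :
    reverseFlow ρ T x 0 z = z := by
  have hone : (fun j => √(forwardVar (T - 0) (covEig ρ x j)) / √(forwardVar T (covEig ρ x j))) =
      1 := by
    ext j
    rw [sub_zero, Pi.one_apply,
      div_self (Real.sqrt_pos.2 (forwardVar_pos hT (covEig_nonneg hρ x j))).ne']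
  rw [reverseFlow, hone, map_one, sub_zero, one_apply_eq_self, add_sub_cancel]

lemma continuous_reverseFlow (ρ T : ℝ) (x : ι → E) (z : E) :
    Continuous fun s => reverseFlow ρ T x s z := by
  simp_rw [reverseFlow, diagonalOp_apply]
  refine Continuous.add ?_ (continuous_finsetSum _ fun j _ => ?_)
  · unfold signal
    fun_prop
  · exact ((((continuous_forwardVar_sub _ _).sqrt).div_const _).mul_const _).smul continuous_const

lemma hasDerivAt_reverseFlow [Nonempty ι] {ρ T s : ℝ} (hρ : 0 ≤ ρ) (hs : s < T) (x : ι → E)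
    (z : E) :
    HasDerivAt (fun s => reverseFlow ρ T x s z)
      (reverseDrift ρ T x s (reverseFlow ρ T x s z)) s := by
  set c := z - (signal T * (1 - ρ)) • sampleMean x with hc
  have hmean := ((hasDerivAt_signal_sub T s).mul_const (1 - ρ)).smul_const (sampleMean x)
  have hcoord := HasDerivAt.fun_sum fun j (_ : j ∈ Finset.univ) =>
    (((hasDerivAt_sqrt_forwardVar_sub hs (covEig_nonneg hρ x j)).div_const
      √(forwardVar T (covEig ρ x j))).mul_const (inner ℝ (covBasis ρ x j) c)).smul_const
        (covBasis ρ x j)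
  have hflow : (fun s => reverseFlow ρ T x s z) = fun s =>
      (signal (T - s) * (1 - ρ)) • sampleMean x + ∑ j, (√(forwardVar (T - s) (covEig ρ x j)) /
        √(forwardVar T (covEig ρ x j)) * inner ℝ (covBasis ρ x j) c) • covBasis ρ x j := by
    simp_rw [reverseFlow, diagonalOp_apply, hc]
  rw [hflow]
  refine (hmean.add hcoord).congr_deriv
    (InnerProductSpace.ext_inner_left_basis (covBasis ρ x).toBasis fun j => ?_)
  rw [OrthonormalBasis.coe_toBasis, ← diagonalOp_apply, reverseDrift, reverseFlow, ← hc]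
  simp only [inner_sub_right, inner_add_right, inner_diagonalOp]
  ring

/-- The standard deviation of a generated coordinate along an eigenvector with eigenvalue `l`. -/
def genStd (T l : ℝ) : ℝ := √l / √(forwardVar T l)

/-- The mean of the generated distribution. -/
def genMean (ρ T : ℝ) (x : ι → E) : E :=
  (1 - ρ) • sampleMean x - diagonalOp (covBasis ρ x) (fun j => genStd T (covEig ρ x j))
    ((signal T * (1 - ρ)) • sampleMean x)

/-- The map from the initial noise to the generated point. -/
def genMap (ρ T : ℝ) (x : ι → E) (z : E) : E :=
  genMean ρ T x + diagonalOp (covBasis ρ x) (fun j => genStd T (covEig ρ x j)) z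

lemma reverseFlow_self (ρ T : ℝ) (x : ι → E) : reverseFlow ρ T x T = genMap ρ T x := by
  ext1 z
  simp only [reverseFlow, genMap, genMean, genStd, sub_self, forwardVar_zero, signal_zero, one_mul,
    map_sub]
  abel

lemma eq_genMap_of_hasDerivWithinAt [Nonempty ι] {ρ T : ℝ} (hρ : 0 ≤ ρ) (hT : 0 < T) (x : ι → E)
    {y : ℝ → E} (hy : ContinuousOn y (Set.Icc 0 T))
    (hy' : ∀ s ∈ Set.Ico 0 T, HasDerivWithinAt y (reverseDrift ρ T x s (y s)) (Set.Icc 0 T) s) :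
    y T = genMap ρ T x (y 0) := by
  have hsignal : Continuous fun s => (signal (T - s) * (1 - ρ)) • sampleMean x := by
    unfold signal
    fun_prop
  refine InnerProductSpace.ext_inner_left_basis (covBasis ρ x).toBasis fun j => ?_
  rw [OrthonormalBasis.coe_toBasis]
  let L := innerSL ℝ (covBasis ρ x j)
  have hcoord := eq_div_mul_of_hasDerivWithinAt
    (y := fun s => L (y s - (signal (T - s) * (1 - ρ)) • sampleMean x))
    (g := fun s => √(forwardVar (T - s) (covEig ρ x j)))
    (a := fun s => 1 - (forwardVar (T - s) (covEig ρ x j))⁻¹) hT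
    (L.continuous.comp_continuousOn (hy.sub hsignal.continuousOn))
    (continuous_forwardVar_sub _ _).sqrt.continuousOn (fun s hs => ?_)
    (fun s hs => (hasDerivAt_sqrt_forwardVar_sub hs.2 (covEig_nonneg hρ x j)).hasDerivWithinAt)
    (fun s hs => (Real.sqrt_pos.2 (forwardVar_pos (sub_pos.2 hs.2) (covEig_nonneg hρ x j))).ne')
  · simp only [L, innerSL_apply_apply, sub_self, signal_zero, one_mul, sub_zero, forwardVar_zero,
      inner_sub_right] at hcoord
    rw [genMap, genMean, inner_add_right, inner_sub_right, inner_diagonalOp, inner_diagonalOp,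
      genStd]
    linarith
  · refine (L.hasFDerivAt.comp_hasDerivWithinAt s ((hy' s hs).sub
      (((hasDerivAt_signal_sub T s).mul_const (1 - ρ)).smul_const
        (sampleMean x)).hasDerivWithinAt)).congr_deriv ?_
    simp only [L, innerSL_apply_apply, reverseDrift, inner_sub_right, inner_diagonalOp]
    ring

end Flow

/-- The law of the output for a class with training points `x`, for a model trained with corruption
level `γ`. -/
def generatedLaw {ι E : Type*} [Fintype ι] [NormedAddCommGroup E] [InnerProductSpace ℝ E]
    [FiniteDimensional ℝ E] [MeasurableSpace E] [BorelSpace E] (γ T : ℝ) (x : ι → E) : Measure E :=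
  (stdGaussian E).map (genMap (shrinkage γ) T x)

lemma IsTrained.self_add_scoreEstimate {K d : ℕ} {n : Fin K → ℕ} {w : Fin K → ℝ}
    (hw : ∀ k, 0 < w k) {X : Dataset n d} {γ : ℝ} {θ : ℝ → LinearDenoiser K d}
    (h : IsTrained w X γ θ) {s T : ℝ} (hs : s < T) (k : Fin K) [NeZero (n k)] (z : Euc d) :
    z + scoreEstimate θ k (T - s) z = reverseDrift (shrinkage γ) T (X k) s z := by
  rw [h.scoreEstimate_eq hw (sub_pos.2 hs), ← sub_eq_add_neg, reverseDrift]

lemma isGenerationLaw_iff {K d : ℕ} {n : Fin K → ℕ} {w : Fin K → ℝ} (hw : ∀ k, 0 < w k)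
    (X : Dataset n d) (γ : ℝ) (k : Fin K) [NeZero (n k)] {T : ℝ} (hT : 0 < T)
    (Q : Measure (Euc d)) :
    IsGenerationLaw w X γ k T Q ↔ Q = generatedLaw γ T (X k) := by
  constructor
  · rintro ⟨θ, Φ, hθ, hΦ, -, rfl⟩
    rw [generatedLaw, show Φ T = genMap (shrinkage γ) T (X k) from funext fun z => ?_]
    obtain ⟨h0, hc, hd⟩ := hΦ z
    have h := eq_genMap_of_hasDerivWithinAt (shrinkage_nonneg γ) hT (X k) hc fun s hs =>
      (hd s hs).congr_deriv (hθ.self_add_scoreEstimate hw hs.2 k _)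
    rwa [h0] at h
  · rintro rfl
    have hθ := isTrained_optDenoiser hw X γ
    refine ⟨_, reverseFlow (shrinkage γ) T (X k), hθ, fun z =>
      ⟨reverseFlow_zero (shrinkage_nonneg γ) hT _ _, (continuous_reverseFlow _ _ _ _).continuousOn,
        fun s hs => ?_⟩, ?_, ?_⟩
    · rw [hθ.self_add_scoreEstimate hw hs.2 k]
      exact (hasDerivAt_reverseFlow (shrinkage_nonneg γ) hs.2 _ _).hasDerivWithinAt
    · rw [reverseFlow_self]
      unfold genMap
      fun_prop
    · rw [reverseFlow_self, generatedLaw]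

/-! ### Wasserstein distance -/

section Covariance

variable {Ω : Type*} {mΩ : MeasurableSpace Ω} {π : Measure Ω} [IsFiniteMeasure π] {X Y : Ω → ℝ}

lemma covariance_sq_le (hX : MemLp X 2 π) (hY : MemLp Y 2 π) :
    cov[X, Y; π] ^ 2 ≤ Var[X; π] * Var[Y; π] := by
  have h := discrim_le_zero (a := Var[Y; π]) (b := -2 * cov[X, Y; π]) (c := Var[X; π]) fun r => by
    have hvar := variance_nonneg (X - r • Y) π
    rw [variance_sub hX (hY.const_smul r), variance_smul, covariance_smul_right] at hvar
    linarith
  rw [discrim] at h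
  linarith

lemma sq_integral_sub_add_sq_sqrt_variance_sub_le [IsProbabilityMeasure π] (hX : MemLp X 2 π)
    (hY : MemLp Y 2 π) :
    (π[X] - π[Y]) ^ 2 + (√Var[X; π] - √Var[Y; π]) ^ 2 ≤ ∫ ω, (X ω - Y ω) ^ 2 ∂π := by
  have hcov : cov[X, Y; π] ≤ √Var[X; π] * √Var[Y; π] := by
    rw [← Real.sqrt_mul (variance_nonneg X π)]
    exact (le_abs_self _).trans (Real.abs_le_sqrt (covariance_sq_le hX hY))
  have hvar := variance_sub hX hY
  rw [variance_eq_sub (hX.sub hY), integral_sub' (hX.integrable one_le_two)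
    (hY.integrable one_le_two)] at hvar
  simp only [Pi.pow_apply, Pi.sub_apply] at hvar
  have hXsq := Real.sq_sqrt (variance_nonneg X π)
  have hYsq := Real.sq_sqrt (variance_nonneg Y π)
  linarith

end Covariance

section Wasserstein

variable {ι : Type*} [Fintype ι] {d : ℕ}

lemma wasserstein2_map_le {Ω : Type*} {mΩ : MeasurableSpace Ω} (π : Measure Ω) {f g : Ω → Euc d}
    (hf : Measurable f) (hg : Measurable g) :
    wasserstein2 (π.map f) (π.map g) ≤ (∫⁻ ω, edist (f ω) (g ω) ^ 2 ∂π) ^ (1 / 2 : ℝ) := by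
  refine ENNReal.rpow_le_rpow
    ((iInf₂_le (π.map fun ω => (f ω, g ω))
      ⟨Measure.fst_map_prodMk hg, Measure.snd_map_prodMk hf⟩).trans
        (lintegral_map (by fun_prop) (hf.prodMk hg)).le) (by norm_num)

lemma ofReal_sum_le_lintegral_edist_sq {P Q : Measure (Euc d)} [IsProbabilityMeasure P]
    (hP : MemLp id 2 P) (hQ : MemLp id 2 Q) (u : OrthonormalBasis ι ℝ (Euc d))
    {π : Measure (Euc d × Euc d)} (hπP : π.fst = P) (hπQ : π.snd = Q) :
    ENNReal.ofReal (∑ i, ((P[fun z => inner ℝ (u i) z] - Q[fun z => inner ℝ (u i) z]) ^ 2 +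
        (√Var[fun z => inner ℝ (u i) z; P] - √Var[fun z => inner ℝ (u i) z; Q]) ^ 2)) ≤
      ∫⁻ p, edist p.1 p.2 ^ 2 ∂π := by
  subst hπP hπQ
  have : IsProbabilityMeasure (π.map Prod.fst) := ‹IsProbabilityMeasure π.fst›
  have hprob : IsProbabilityMeasure π := Measure.isProbabilityMeasure_of_map Prod.fst
  have hL (i : ι) : Measurable fun z : Euc d => inner ℝ (u i) z := by fun_prop
  have hfst (i : ι) : MemLp (fun p : Euc d × Euc d => inner ℝ (u i) p.1) 2 π :=
    (hP.const_inner (u i)).comp_of_map measurable_fst.aemeasurable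
  have hsnd (i : ι) : MemLp (fun p : Euc d × Euc d => inner ℝ (u i) p.2) 2 π :=
    (hQ.const_inner (u i)).comp_of_map measurable_snd.aemeasurable
  have hdist (p : Euc d × Euc d) : edist p.1 p.2 ^ 2 =
      ENNReal.ofReal (∑ i, (inner ℝ (u i) p.1 - inner ℝ (u i) p.2) ^ 2) := by
    simp_rw [edist_dist, ← ENNReal.ofReal_pow dist_nonneg, dist_eq_norm, ← u.sum_sq_inner_right,
      inner_sub_right]
  have hint (i : ι) : Integrable
      (fun p : Euc d × Euc d => (inner ℝ (u i) p.1 - inner ℝ (u i) p.2) ^ 2) π :=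
    ((hfst i).sub (hsnd i)).integrable_sq
  simp_rw [hdist]
  rw [← ofReal_integral_eq_lintegral_ofReal (integrable_finsetSum _ fun i _ => hint i)
    (ae_of_all _ fun _ => Finset.sum_nonneg fun _ _ => sq_nonneg _),
    integral_finsetSum _ fun i _ => hint i]
  refine ENNReal.ofReal_le_ofReal (Finset.sum_le_sum fun i _ => ?_)
  rw [Measure.fst, Measure.snd, variance_map (hL i).aemeasurable (by fun_prop),
    variance_map (hL i).aemeasurable (by fun_prop),
    integral_map (by fun_prop) (hL i).aestronglyMeasurable,
    integral_map (by fun_prop) (hL i).aestronglyMeasurable]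
  exact sq_integral_sub_add_sq_sqrt_variance_sub_le (hfst i) (hsnd i)

lemma le_wasserstein2 {P Q : Measure (Euc d)} [IsProbabilityMeasure P]
    (hP : MemLp id 2 P) (hQ : MemLp id 2 Q) (u : OrthonormalBasis ι ℝ (Euc d)) :
    ENNReal.ofReal (∑ i, ((P[fun z => inner ℝ (u i) z] - Q[fun z => inner ℝ (u i) z]) ^ 2 +
        (√Var[fun z => inner ℝ (u i) z; P] - √Var[fun z => inner ℝ (u i) z; Q]) ^ 2)) ^
          (1 / 2 : ℝ) ≤ wasserstein2 P Q :=
  ENNReal.rpow_le_rpow (le_iInf₂ fun _ hπ => ofReal_sum_le_lintegral_edist_sq hP hQ u hπ.1 hπ.2)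
    (by norm_num)

variable (a b : Euc d) (u : OrthonormalBasis ι ℝ (Euc d)) (α β : ι → ℝ)

lemma inner_add_diagonalOp (i : ι) (z : Euc d) :
    inner ℝ (u i) (a + diagonalOp u α z) = inner ℝ (u i) a + inner ℝ (α i • u i) z := by
  rw [inner_add_right, inner_diagonalOp, real_inner_smul_left]

lemma memLp_id_map_add_diagonalOp :
    MemLp id 2 ((stdGaussian (Euc d)).map fun z => a + diagonalOp u α z) := by
  rw [memLp_map_measure_iff (by fun_prop) (by fun_prop)]
  exact (memLp_const a).add ((diagonalOp u α).comp_memLp' IsGaussian.memLp_two_id)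

lemma integral_inner_map_add_diagonalOp (i : ι) :
    ∫ z, inner ℝ (u i) z ∂((stdGaussian (Euc d)).map fun z => a + diagonalOp u α z) =
      inner ℝ (u i) a := by
  rw [integral_map (by fun_prop) (by fun_prop)]
  simp_rw [inner_add_diagonalOp, integral_add_inner_stdGaussian]

lemma variance_inner_map_add_diagonalOp (i : ι) :
    Var[fun z => inner ℝ (u i) z; (stdGaussian (Euc d)).map fun z => a + diagonalOp u α z] =
      α i ^ 2 := by
  rw [variance_map (by fun_prop) (by fun_prop), Function.comp_def]
  simp_rw [inner_add_diagonalOp, variance_add_inner_stdGaussian, norm_smul, u.norm_eq_one,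
    mul_one, Real.norm_eq_abs, sq_abs]

variable {α β}

lemma wasserstein2_map_add_diagonalOp (hα : ∀ i, 0 ≤ α i) (hβ : ∀ i, 0 ≤ β i) :
    wasserstein2 ((stdGaussian (Euc d)).map fun z => a + diagonalOp u α z)
        ((stdGaussian (Euc d)).map fun z => b + diagonalOp u β z) =
      ENNReal.ofReal (‖a - b‖ ^ 2 + ∑ i, (α i - β i) ^ 2) ^ (1 / 2 : ℝ) := by
  refine le_antisymm ?_ ?_
  · have hdist (z : Euc d) : edist (a + diagonalOp u α z) (b + diagonalOp u β z) ^ 2 =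
        ENNReal.ofReal (‖(a - b) + diagonalOp u (α - β) z‖ ^ 2) := by
      rw [edist_dist, ← ENNReal.ofReal_pow dist_nonneg, dist_eq_norm, map_sub, sub_apply,
        add_sub_add_comm]
    refine (wasserstein2_map_le _ (by fun_prop) (by fun_prop)).trans_eq ?_
    simp_rw [hdist]
    rw [← ofReal_integral_eq_lintegral_ofReal (integrable_norm_add_apply_sq_stdGaussian _ _)
      (ae_of_all _ fun _ => sq_nonneg _), integral_norm_add_apply_sq_stdGaussian u]
    simp_rw [diagonalOp_apply_self, norm_smul, u.norm_eq_one, mul_one, Real.norm_eq_abs, sq_abs,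
      Pi.sub_apply]
  · have hprob : IsProbabilityMeasure
        ((stdGaussian (Euc d)).map fun z => a + diagonalOp u α z) :=
      Measure.isProbabilityMeasure_map (by fun_prop)
    refine le_of_eq_of_le ?_ (le_wasserstein2 (memLp_id_map_add_diagonalOp a u α)
      (memLp_id_map_add_diagonalOp b u β) u)
    simp_rw [integral_inner_map_add_diagonalOp, variance_inner_map_add_diagonalOp,
      Real.sqrt_sq (hα _), Real.sqrt_sq (hβ _), Finset.sum_add_distrib, ← inner_sub_right,
      u.sum_sq_inner_right]

lemma multivariateGaussian_one (μ : Euc d) :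
    multivariateGaussian μ 1 = (stdGaussian (Euc d)).map (fun z => μ + z) := by
  simp [multivariateGaussian]

end Wasserstein

/-- The squared distance of the distribution generated from the points `x` to the Gaussian with mean
`μ` and unit covariance. -/
def genErr {ι E : Type*} [Fintype ι] [NormedAddCommGroup E] [InnerProductSpace ℝ E]
    [FiniteDimensional ℝ E] (μ : E) (ρ T : ℝ) (x : ι → E) : ℝ :=
  ‖μ - genMean ρ T x‖ ^ 2 + ∑ j, (1 - genStd T (covEig ρ x j)) ^ 2

section GenErr

variable {ι E : Type*} [Fintype ι] [NormedAddCommGroup E] [InnerProductSpace ℝ E]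
  [FiniteDimensional ℝ E] {d : ℕ}

lemma genErr_nonneg (μ : E) (ρ T : ℝ) (x : ι → E) : 0 ≤ genErr μ ρ T x := by
  unfold genErr
  positivity

lemma genErr_eq_zero [Subsingleton E] (μ : E) (ρ T : ℝ) (x : ι → E) : genErr μ ρ T x = 0 := by
  have hrank : Module.finrank ℝ E = 0 := Module.finrank_zero_of_subsingleton
  have : IsEmpty (Fin (Module.finrank ℝ E)) := by
    rw [hrank]
    infer_instance
  rw [genErr, Subsingleton.elim (μ - genMean ρ T x) 0]
  simp

lemma genStd_nonneg (T l : ℝ) : 0 ≤ genStd T l := by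
  unfold genStd
  positivity

lemma wasserstein2_generatedLaw (μ : Euc d) (γ T : ℝ) (x : ι → Euc d) :
    wasserstein2 (multivariateGaussian μ 1) (generatedLaw γ T x) =
      ENNReal.ofReal (genErr μ (shrinkage γ) T x) ^ (1 / 2 : ℝ) := by
  have h := wasserstein2_map_add_diagonalOp μ (genMean (shrinkage γ) T x)
    (covBasis (shrinkage γ) x) (α := 1) (fun _ => zero_le_one)
    fun j => genStd_nonneg T (covEig (shrinkage γ) x j)
  simp_rw [map_one, one_apply_eq_self, ← multivariateGaussian_one] at h
  exact h

lemma wasserstein2_generatedLaw_ne_top (μ : Euc d) (γ T : ℝ) (x : ι → Euc d) :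
    wasserstein2 (multivariateGaussian μ 1) (generatedLaw γ T x) ≠ ∞ := by
  rw [wasserstein2_generatedLaw]
  exact ENNReal.rpow_ne_top_of_nonneg (by norm_num) ENNReal.ofReal_ne_top

lemma toReal_wasserstein2_generatedLaw_sq (μ : Euc d) (γ T : ℝ) (x : ι → Euc d) :
    (wasserstein2 (multivariateGaussian μ 1) (generatedLaw γ T x)).toReal ^ 2 =
      genErr μ (shrinkage γ) T x := by
  rw [wasserstein2_generatedLaw, ← ENNReal.toReal_rpow,
    ENNReal.toReal_ofReal (genErr_nonneg _ _ _ _), ← Real.sqrt_eq_rpow,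
    Real.sq_sqrt (genErr_nonneg _ _ _ _)]

end GenErr

/-! ### Comparison of the errors for a fixed training set -/

lemma mul_three_sub_div_four_le_sqrt_sub_sqrt {l δ : ℝ} (hδ : 0 ≤ δ) (hl : δ ≤ l) :
    δ * (3 - l) / 4 ≤ √l - √(l - δ) := by
  have ha := Real.sq_sqrt (hδ.trans hl)
  have hb := Real.sq_sqrt (sub_nonneg.2 hl)
  have hba : √(l - δ) ≤ √l := Real.sqrt_le_sqrt (by linarith)
  have hb0 := Real.sqrt_nonneg (l - δ)
  set a := √l
  set b := √(l - δ)
  have hsum : (a + b) * (3 - a ^ 2) ≤ 4 := by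
    rcases le_total (3 - a ^ 2) 0 with h | h
    · nlinarith
    · nlinarith [mul_nonneg (sq_nonneg (a - 1)) (by linarith : 0 ≤ a + 2)]
  calc δ * (3 - l) / 4 = (a - b) * ((a + b) * (3 - a ^ 2)) / 4 := by
        rw [show δ = (a - b) * (a + b) by linarith, ← ha]
        ring
    _ ≤ (a - b) * 4 / 4 := by
        gcongr
    _ = a - b := by ring

lemma sqrt_sub_sqrt_sub_nonneg {l δ : ℝ} (hδ : 0 ≤ δ) : 0 ≤ √l - √(l - δ) :=
  sub_nonneg.2 (Real.sqrt_le_sqrt (sub_le_self l hδ))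

section Pointwise

variable {ι E : Type*} [Fintype ι] [NormedAddCommGroup E] [InnerProductSpace ℝ E]
  [FiniteDimensional ℝ E]

lemma inner_covBasis_covOp_zero (ρ : ℝ) (x : ι → E) (j : Fin (Module.finrank ℝ E)) :
    inner ℝ (covBasis ρ x j) (covOp 0 x (covBasis ρ x j)) =
      covEig ρ x j - ρ * inner ℝ (sampleMean x) (covBasis ρ x j) ^ 2 := by
  rw [← inner_covBasis_covOp, inner_covOp, inner_covOp, real_inner_comm (sampleMean x)]
  ring

lemma mul_inner_sampleMean_sq_le_covEig [Nonempty ι] (ρ : ℝ) (x : ι → E)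
    (j : Fin (Module.finrank ℝ E)) :
    ρ * inner ℝ (sampleMean x) (covBasis ρ x j) ^ 2 ≤ covEig ρ x j := by
  rw [← sub_nonneg, ← inner_covBasis_covOp_zero, inner_covOp_self]
  positivity

/-- The gain in the trace of the square root of `covOp` over the sample covariance. -/
def sqrtGain (ρ : ℝ) (x : ι → E) : ℝ := ∑ j, √(covEig ρ x j) - ∑ j, √(covEig 0 x j)

lemma sum_sqrt_sub_le_sqrtGain [Nonempty ι] (ρ : ℝ) (x : ι → E) :
    ∑ j, (√(covEig ρ x j) -
      √(covEig ρ x j - ρ * inner ℝ (sampleMean x) (covBasis ρ x j) ^ 2)) ≤ sqrtGain ρ x := by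
  have hpeierls := sum_le_sum_inner_of_concaveOn (covBasis 0 x) (covEig 0 x)
    Real.strictConcaveOn_sqrt.concaveOn (covEig_nonneg le_rfl x) (covBasis ρ x)
  simp_rw [← covOp_eq_diagonalOp, inner_covBasis_covOp_zero] at hpeierls
  rw [Finset.sum_sub_distrib]
  exact sub_le_sub_left hpeierls _

lemma sqrtGain_nonneg [Nonempty ι] {ρ : ℝ} (hρ : 0 ≤ ρ) (x : ι → E) : 0 ≤ sqrtGain ρ x :=
  (Finset.sum_nonneg fun _ _ => sqrt_sub_sqrt_sub_nonneg (mul_nonneg hρ (sq_nonneg _))).trans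
    (sum_sqrt_sub_le_sqrtGain ρ x)

lemma le_sqrtGain [Nonempty ι] {ρ : ℝ} (hρ : 0 ≤ ρ) (x : ι → E) :
    ρ / 4 * (3 * ‖sampleMean x‖ ^ 2 -
      (Fintype.card ι : ℝ)⁻¹ * ∑ i, inner ℝ (x i - sampleMean x) (sampleMean x) ^ 2 -
      ρ * ‖sampleMean x‖ ^ 4) ≤ sqrtGain ρ x := by
  have hquad := inner_covOp_self ρ x (sampleMean x)
  rw [covOp_eq_diagonalOp, inner_diagonalOp_self, real_inner_self_eq_norm_sq] at hquad
  calc _ = ρ / 4 * (3 * ‖sampleMean x‖ ^ 2 -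
        ∑ j, covEig ρ x j * inner ℝ (covBasis ρ x j) (sampleMean x) ^ 2) := by
        rw [hquad]
        ring
    _ = ∑ j, ρ * inner ℝ (sampleMean x) (covBasis ρ x j) ^ 2 * (3 - covEig ρ x j) / 4 := by
        rw [← (covBasis ρ x).sum_sq_inner_right, Finset.mul_sum, ← Finset.sum_sub_distrib,
          Finset.mul_sum]
        simp_rw [real_inner_comm (sampleMean x)]
        exact Finset.sum_congr rfl fun j _ => by ring
    _ ≤ ∑ j, (√(covEig ρ x j) -
          √(covEig ρ x j - ρ * inner ℝ (sampleMean x) (covBasis ρ x j) ^ 2)) :=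
        Finset.sum_le_sum fun j _ => mul_three_sub_div_four_le_sqrt_sub_sqrt (by positivity)
          (mul_inner_sampleMean_sq_le_covEig ρ x j)
    _ ≤ sqrtGain ρ x := sum_sqrt_sub_le_sqrtGain ρ x

lemma sum_covEig (ρ : ℝ) (x : ι → E) :
    ∑ j, covEig ρ x j =
      (Fintype.card ι : ℝ)⁻¹ * ∑ i, ‖x i‖ ^ 2 - (1 - ρ) * ‖sampleMean x‖ ^ 2 := by
  simpa using sum_covEig_mul_norm_sq ρ x (ContinuousLinearMap.id ℝ E)

/-- The limit of `genErr` as the length of the diffusion tends to infinity. -/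
def genErrLim (μ : E) (ρ : ℝ) (x : ι → E) : ℝ :=
  ‖μ - (1 - ρ) • sampleMean x‖ ^ 2 + ∑ j, (1 - √(covEig ρ x j)) ^ 2

lemma genErrLim_eq [Nonempty ι] (μ : E) {ρ : ℝ} (hρ : 0 ≤ ρ) (x : ι → E) :
    genErrLim μ ρ x =
      ‖μ - (1 - ρ) • sampleMean x‖ ^ 2 + Module.finrank ℝ E - 2 * ∑ j, √(covEig ρ x j) +
      ((Fintype.card ι : ℝ)⁻¹ * ∑ i, ‖x i‖ ^ 2 - (1 - ρ) * ‖sampleMean x‖ ^ 2) := by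
  simp_rw [genErrLim, sub_sq, Real.sq_sqrt (covEig_nonneg hρ x _), one_pow, mul_one,
    Finset.sum_add_distrib, Finset.sum_sub_distrib, ← Finset.mul_sum, sum_covEig, Finset.sum_const,
    Finset.card_univ, Fintype.card_fin, nsmul_eq_mul, mul_one]
  ring

lemma genErrLim_zero_sub [Nonempty ι] (μ : E) {ρ : ℝ} (hρ : 0 ≤ ρ) (x : ι → E) :
    genErrLim μ 0 x - genErrLim μ ρ x = ρ * (1 - ρ) * ‖sampleMean x‖ ^ 2 -
      2 * ρ * inner ℝ μ (sampleMean x) + 2 * sqrtGain ρ x := by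
  rw [genErrLim_eq μ le_rfl, genErrLim_eq μ hρ, sqrtGain, sub_zero, one_smul,
    norm_sub_sq_real, norm_sub_sq_real, inner_smul_right, norm_smul, mul_pow, Real.norm_eq_abs,
    sq_abs]
  ring

lemma tendsto_exp_neg_two_mul : Tendsto (fun T : ℝ => Real.exp (-2 * T)) atTop (nhds 0) :=
  Real.tendsto_exp_atBot.comp (tendsto_id.const_mul_atTop_of_neg (by norm_num))

lemma tendsto_signal : Tendsto signal atTop (nhds 0) :=
  Real.tendsto_exp_atBot.comp tendsto_neg_atTop_atBot

lemma tendsto_genStd (l : ℝ) : Tendsto (fun T => genStd T l) atTop (nhds √l) := by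
  have hvar : Tendsto (fun T => forwardVar T l) atTop (nhds (0 * l + (1 - 0))) :=
    (tendsto_exp_neg_two_mul.mul_const l).add (tendsto_exp_neg_two_mul.const_sub 1)
  simpa [genStd, Pi.div_def] using (tendsto_const_nhds (x := √l)).div hvar.sqrt (by simp)

lemma tendsto_genMean (ρ : ℝ) (x : ι → E) :
    Tendsto (fun T => genMean ρ T x) atTop (nhds ((1 - ρ) • sampleMean x)) := by
  have hop : Tendsto (fun T => diagonalOp (covBasis ρ x) fun j => genStd T (covEig ρ x j)) atTop
      (nhds (diagonalOp (covBasis ρ x) fun j => √(covEig ρ x j))) :=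
    tendsto_diagonalOp _ _ fun j => tendsto_genStd _
  have hvec := (tendsto_signal.mul_const (1 - ρ)).smul_const (sampleMean x)
  have happ := (isBoundedBilinearMap_apply.continuous.tendsto _).comp (hop.prodMk_nhds hvec)
  simpa [genMean, Function.comp_def] using happ.const_sub ((1 - ρ) • sampleMean x)

lemma tendsto_genErr (μ : E) (ρ : ℝ) (x : ι → E) :
    Tendsto (fun T => genErr μ ρ T x) atTop (nhds (genErrLim μ ρ x)) :=
  (((tendsto_genMean ρ x).const_sub μ).norm.pow 2).add
    (tendsto_finsetSum _ fun _ _ => ((tendsto_genStd _).const_sub 1).pow 2)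

lemma genStd_mul_signal_le_one {T l : ℝ} (hT : 0 < T) (hl : 0 ≤ l) :
    genStd T l * signal T ≤ 1 := by
  have hsignal : signal T = √(Real.exp (-2 * T)) := by
    rw [← signal_sq, Real.sqrt_sq (show 0 ≤ signal T from (Real.exp_pos _).le)]
  rw [genStd, div_mul_eq_mul_div, div_le_one (Real.sqrt_pos.2 (forwardVar_pos hT hl)), hsignal,
    ← Real.sqrt_mul hl, mul_comm]
  exact Real.sqrt_le_sqrt (le_add_of_nonneg_right (sub_nonneg.2 (exp_neg_two_mul_lt_one hT).le))

lemma genStd_sq_le {T l : ℝ} (hT : 1 ≤ T) (hl : 0 ≤ l) : genStd T l ^ 2 ≤ 2 * l := by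
  have hv := forwardVar_pos (zero_lt_one.trans_le hT) hl
  have hexp : Real.exp (-2 * T) ≤ 1 / 2 := by
    rw [neg_mul, Real.exp_neg, one_div]
    exact inv_anti₀ two_pos (by linarith [Real.add_one_le_exp (2 * T)])
  have hhalf : 1 / 2 ≤ forwardVar T l := by
    have := mul_nonneg (Real.exp_pos (-2 * T)).le hl
    unfold forwardVar
    linarith
  rw [genStd, div_pow, Real.sq_sqrt hl, Real.sq_sqrt hv.le, div_le_iff₀ hv]
  nlinarith

lemma norm_genMean_le [Nonempty ι] {ρ T : ℝ} (hρ : 0 ≤ ρ) (hρ1 : ρ ≤ 1) (hT : 0 < T)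
    (x : ι → E) : ‖genMean ρ T x‖ ≤ ‖sampleMean x‖ := by
  rw [← sq_le_sq₀ (norm_nonneg _) (norm_nonneg _), ← (covBasis ρ x).sum_sq_inner_right,
    ← (covBasis ρ x).sum_sq_inner_right (sampleMean x)]
  refine Finset.sum_le_sum fun j _ => ?_
  have hle := genStd_mul_signal_le_one hT (covEig_nonneg hρ x j)
  have hnonneg : 0 ≤ genStd T (covEig ρ x j) * signal T :=
    mul_nonneg (genStd_nonneg _ _) (Real.exp_pos _).le
  have hcoord : inner ℝ (covBasis ρ x j) (genMean ρ T x) =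
      ((1 - ρ) * (1 - genStd T (covEig ρ x j) * signal T)) *
        inner ℝ (covBasis ρ x j) (sampleMean x) := by
    rw [genMean, inner_sub_right, inner_diagonalOp, inner_smul_right, inner_smul_right]
    ring
  rw [hcoord, mul_pow]
  exact mul_le_of_le_one_left (sq_nonneg _) (pow_le_one₀
    (mul_nonneg (by linarith) (by linarith))
    (mul_le_one₀ (by linarith) (by linarith) (by linarith)))

lemma genErr_le [Nonempty ι] (μ : E) {ρ T : ℝ} (hρ : 0 ≤ ρ) (hρ1 : ρ ≤ 1) (hT : 1 ≤ T)
    (x : ι → E) :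
    genErr μ ρ T x ≤ 2 * ‖μ‖ ^ 2 + 2 * ‖sampleMean x‖ ^ 2 + 2 * Module.finrank ℝ E +
      4 * ((Fintype.card ι : ℝ)⁻¹ * ∑ i, ‖x i‖ ^ 2) := by
  have hmean : ‖μ - genMean ρ T x‖ ^ 2 ≤ 2 * ‖μ‖ ^ 2 + 2 * ‖sampleMean x‖ ^ 2 := by
    have := (norm_sub_le μ (genMean ρ T x)).trans
      (add_le_add_right (norm_genMean_le hρ hρ1 (zero_lt_one.trans_le hT) x) _)
    nlinarith [norm_nonneg (μ - genMean ρ T x), sq_nonneg (‖μ‖ - ‖sampleMean x‖)]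
  have hstd : ∑ j, (1 - genStd T (covEig ρ x j)) ^ 2 ≤
      2 * Module.finrank ℝ E + 4 * ∑ j, covEig ρ x j := by
    calc ∑ j, (1 - genStd T (covEig ρ x j)) ^ 2 ≤ ∑ j, (2 + 4 * covEig ρ x j) := by
          refine Finset.sum_le_sum fun j _ => ?_
          have := genStd_sq_le hT (covEig_nonneg hρ x j)
          nlinarith [sq_nonneg (1 + genStd T (covEig ρ x j))]
      _ = _ := by
          simp_rw [Finset.sum_add_distrib, ← Finset.mul_sum, Finset.sum_const, Finset.card_univ,
            Fintype.card_fin, nsmul_eq_mul, mul_comm]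
  rw [sum_covEig] at hstd
  have hnonneg : 0 ≤ (1 - ρ) * ‖sampleMean x‖ ^ 2 := mul_nonneg (by linarith) (sq_nonneg _)
  rw [genErr]
  linarith

end Pointwise

/-! ### Measurability of spectral functions -/

lemma exists_polynomial_tendsto_eval {f : ℝ → ℝ} (hf : Continuous f) :
    ∃ p : ℕ → Polynomial ℝ, ∀ l, Tendsto (fun N => (p N).eval l) atTop (nhds (f l)) := by
  choose p hp using fun N : ℕ => exists_polynomial_near_of_continuousOn (-(N : ℝ)) N f
    hf.continuousOn (1 / ((N : ℝ) + 1)) (by positivity)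
  refine ⟨p, fun l => tendsto_iff_dist_tendsto_zero.2 <|
    squeeze_zero' (Eventually.of_forall fun _ => dist_nonneg) ?_
      tendsto_one_div_add_atTop_nhds_zero_nat⟩
  obtain ⟨N₀, hN₀⟩ := exists_nat_ge |l|
  filter_upwards [eventually_ge_atTop N₀] with N hN
  exact (hp N l (abs_le.1 (hN₀.trans (by exact_mod_cast hN)))).le

section Measurability

variable {ι E : Type*} [Fintype ι] [NormedAddCommGroup E] [InnerProductSpace ℝ E]
  [FiniteDimensional ℝ E]

lemma measurable_diagonalOp_comp {Ω κ : Type*} [MeasurableSpace Ω] [Fintype κ]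
    {b : Ω → OrthonormalBasis κ ℝ E} {l : Ω → κ → ℝ}
    (h : Measurable fun ω => diagonalOp (b ω) (l ω)) {f : ℝ → ℝ} (hf : Continuous f) :
    Measurable fun ω => diagonalOp (b ω) fun j => f (l ω j) := by
  obtain ⟨p, hp⟩ := exists_polynomial_tendsto_eval hf
  refine measurable_of_tendsto_metrizable
    (f := fun N ω => diagonalOp (b ω) fun j => (p N).eval (l ω j)) (fun N => ?_)
    (tendsto_pi_nhds.2 fun ω => tendsto_diagonalOp _ _ fun j => hp _)
  have haeval (ω : Ω) : diagonalOp (b ω) (fun j => (p N).eval (l ω j)) =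
      Polynomial.aeval (diagonalOp (b ω) (l ω)) (p N) := by
    rw [Polynomial.aeval_algHom_apply]
    congr 1 with j
    simp
  simp_rw [haeval]
  exact ((p N).continuous_aeval.measurable).comp h

lemma continuous_genStd {T : ℝ} (hT : 0 < T) : Continuous (genStd T) := by
  have h : genStd T = fun l => √l / √(forwardVar T (max l 0)) := by
    ext1 l
    rcases le_total l 0 with hl | hl
    · rw [genStd, Real.sqrt_eq_zero_of_nonpos hl, zero_div, zero_div]
    · rw [genStd, max_eq_left hl]
  rw [h]
  refine Real.continuous_sqrt.div ?_ fun l =>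
    (Real.sqrt_pos.2 (forwardVar_pos hT (le_max_right _ _))).ne'
  unfold forwardVar
  fun_prop

variable [MeasurableSpace E] [BorelSpace E]

lemma measurable_diagonalOp_covEig (ρ : ℝ) {f : ℝ → ℝ} (hf : Continuous f) :
    Measurable fun x : ι → E => diagonalOp (covBasis ρ x) fun j => f (covEig ρ x j) := by
  refine measurable_diagonalOp_comp ?_ hf
  simp_rw [← covOp_eq_diagonalOp]
  exact (continuous_covOp ρ).measurable

lemma measurable_sum_covEig (ρ : ℝ) {f : ℝ → ℝ} (hf : Continuous f) :
    Measurable fun x : ι → E => ∑ j, f (covEig ρ x j) := by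
  have htrace : Continuous fun S : E →L[ℝ] E => LinearMap.trace ℝ E (S : E →ₗ[ℝ] E) :=
    ((LinearMap.trace ℝ E).comp
      (ContinuousLinearMap.coeLM ℝ)).continuous_of_finiteDimensional
  have h (x : ι → E) := trace_diagonalOp (covBasis ρ x) fun j => f (covEig ρ x j)
  simp_rw [← h]
  exact htrace.measurable.comp (measurable_diagonalOp_covEig ρ hf)

lemma measurable_genMean (ρ : ℝ) {T : ℝ} (hT : 0 < T) :
    Measurable (genMean ρ T : (ι → E) → E) := by
  have happ : Continuous fun p : (E →L[ℝ] E) × E => p.1 p.2 :=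
    isBoundedBilinearMap_apply.continuous
  have hmean : Measurable (sampleMean : (ι → E) → E) := continuous_sampleMean.measurable
  exact (hmean.const_smul _).sub (happ.measurable.comp
    ((measurable_diagonalOp_covEig ρ (continuous_genStd hT)).prodMk (hmean.const_smul _)))

lemma measurable_genErr (μ : E) (ρ : ℝ) {T : ℝ} (hT : 0 < T) :
    Measurable (genErr μ ρ T : (ι → E) → ℝ) :=
  ((measurable_const.sub (measurable_genMean ρ hT)).norm.pow_const 2).add
    (measurable_sum_covEig ρ (f := fun l => (1 - genStd T l) ^ 2)
      ((continuous_const.sub (continuous_genStd hT)).pow 2))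

lemma measurable_genErrLim (μ : E) (ρ : ℝ) : Measurable (genErrLim μ ρ : (ι → E) → ℝ) :=
  ((continuous_const.sub (continuous_sampleMean.const_smul _)).norm.pow 2).measurable.add
    (measurable_sum_covEig ρ (f := fun l => (1 - √l) ^ 2) (by fun_prop))

end Measurability

/-! ### Moments of Gaussian samples -/

section FourthMoment

lemma integral_pow_four_gaussianReal : ∫ x, x ^ 4 ∂(gaussianReal 0 1) = 3 := by
  have hΓ : Real.Gamma (5 / 2) = 3 * √Real.pi / 4 := by
    have h := Real.Gamma_nat_add_half 2
    norm_num [Nat.doubleFactorial] at h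
    exact h
  have hpow : ((1 : ℝ) / 2) ^ (-((4 : ℝ) + 1) / 2) = 4 * √2 := by
    rw [one_div, Real.inv_rpow zero_le_two, ← Real.rpow_neg zero_le_two,
      show -(-((4 : ℝ) + 1) / 2) = 2 + 1 / 2 by norm_num, Real.rpow_add two_pos,
      ← Real.sqrt_eq_rpow]
    norm_num
  have h := integral_rpow_mul_exp_neg_mul_rpow (p := 2) (q := 4) (b := 1 / 2) two_pos
    (by norm_num) (by norm_num)
  rw [show ((4 : ℝ) + 1) / 2 = 5 / 2 by norm_num, hΓ, hpow] at h
  have habs := integral_comp_abs (f := fun x => x ^ (4 : ℝ) * Real.exp (-(1 / 2) * x ^ (2 : ℝ)))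
  rw [h] at habs
  calc ∫ x, x ^ 4 ∂(gaussianReal 0 1)
      = (√(2 * Real.pi))⁻¹ * ∫ x : ℝ, |x| ^ (4 : ℝ) * Real.exp (-(1 / 2) * |x| ^ (2 : ℝ)) := by
        rw [integral_gaussianReal_eq_integral_smul one_ne_zero, ← integral_const_mul]
        congr 1 with x
        have h4 : |x| ^ (4 : ℝ) = x ^ 4 := by
          rw [Real.rpow_ofNat, Even.pow_abs (by decide)]
        have h2 : |x| ^ (2 : ℝ) = x ^ 2 := by rw [Real.rpow_ofNat, sq_abs]
        simp only [gaussianPDFReal, h4, h2, smul_eq_mul, NNReal.coe_one, mul_one, sub_zero]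
        ring_nf
    _ = 3 := by
        rw [habs, Real.sqrt_mul zero_le_two]
        field_simp

variable {E : Type*} [NormedAddCommGroup E] [InnerProductSpace ℝ E] [FiniteDimensional ℝ E]
  [MeasurableSpace E] [BorelSpace E]

lemma map_inner_stdGaussian {v : E} (hv : ‖v‖ = 1) :
    (stdGaussian E).map (fun z => inner ℝ v z) = gaussianReal 0 1 := by
  have h := IsGaussian.map_eq_gaussianReal (μ := stdGaussian E) (innerSL ℝ v)
  rw [integral_strongDual_stdGaussian, variance_dual_stdGaussian, innerSL_apply_norm, hv] at h
  simpa using h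

lemma integral_inner_pow_four_stdGaussian {v : E} (hv : ‖v‖ = 1) :
    ∫ z, inner ℝ v z ^ 4 ∂(stdGaussian E) = 3 := by
  rw [← integral_pow_four_gaussianReal, ← map_inner_stdGaussian hv,
    integral_map (by fun_prop) (by fun_prop)]

lemma integral_norm_pow_four_stdGaussian_le :
    ∫ z, ‖z‖ ^ 4 ∂(stdGaussian E) ≤ 3 * Module.finrank ℝ E ^ 2 := by
  let b := stdOrthonormalBasis ℝ E
  have hmem : MemLp (fun z : E => z) 4 (stdGaussian E) :=
    IsGaussian.memLp_id _ 4 ENNReal.ofNat_ne_top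
  have hcoord (i) : Integrable (fun z => inner ℝ (b i) z ^ 4) (stdGaussian E) := by
    simpa [Even.pow_abs (show Even 4 by decide)] using
      (hmem.const_inner (𝕜 := ℝ) (b i)).integrable_norm_pow (p := 4) (by norm_num)
  have hnorm (z : E) : ‖z‖ ^ 4 ≤ Module.finrank ℝ E * ∑ i, inner ℝ (b i) z ^ 4 := by
    have h := sq_sum_le_card_mul_sum_sq (s := Finset.univ) (f := fun i => inner ℝ (b i) z ^ 2)
    simp_rw [b.sum_sq_inner_right, ← pow_mul, Finset.card_univ, Fintype.card_fin] at h
    exact h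
  calc ∫ z, ‖z‖ ^ 4 ∂(stdGaussian E)
      ≤ ∫ z, Module.finrank ℝ E * ∑ i, inner ℝ (b i) z ^ 4 ∂(stdGaussian E) :=
        integral_mono (hmem.integrable_norm_pow (p := 4) (by norm_num))
          ((integrable_finsetSum _ fun i _ => hcoord i).const_mul _) hnorm
    _ = 3 * Module.finrank ℝ E ^ 2 := by
        simp_rw [integral_const_mul, integral_finsetSum _ fun i _ => hcoord i,
          integral_inner_pow_four_stdGaussian (b.norm_eq_one _), Finset.sum_const,
          Finset.card_univ, Fintype.card_fin, nsmul_eq_mul]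
        ring

lemma integral_norm_add_smul_pow_four_stdGaussian_le (a : E) (c : ℝ) :
    ∫ z, ‖a + c • z‖ ^ 4 ∂(stdGaussian E) ≤
      8 * ‖a‖ ^ 4 + 24 * (c ^ 2 * Module.finrank ℝ E) ^ 2 := by
  have hmem : MemLp (fun z : E => z) 4 (stdGaussian E) :=
    IsGaussian.memLp_id _ 4 ENNReal.ofNat_ne_top
  have hint : Integrable (fun z : E => ‖z‖ ^ 4) (stdGaussian E) :=
    hmem.integrable_norm_pow (p := 4) (by norm_num)
  have hpt (z : E) : ‖a + c • z‖ ^ 4 ≤ 8 * ‖a‖ ^ 4 + 8 * c ^ 4 * ‖z‖ ^ 4 := by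
    calc ‖a + c • z‖ ^ 4 ≤ (‖a‖ + ‖c • z‖) ^ 4 := by gcongr; exact norm_add_le _ _
      _ ≤ 2 ^ 3 * (‖a‖ ^ 4 + ‖c • z‖ ^ 4) := add_pow_le (norm_nonneg _) (norm_nonneg _) 4
      _ = _ := by
        rw [norm_smul, mul_pow, Real.norm_eq_abs, Even.pow_abs (by decide)]
        ring
  calc ∫ z, ‖a + c • z‖ ^ 4 ∂(stdGaussian E)
      ≤ ∫ z, (8 * ‖a‖ ^ 4 + 8 * c ^ 4 * ‖z‖ ^ 4) ∂(stdGaussian E) :=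
        integral_mono ((((memLp_const a).add (hmem.const_smul c))).integrable_norm_pow (p := 4)
          (by norm_num)) ((integrable_const _).add (hint.const_mul _)) hpt
    _ = 8 * ‖a‖ ^ 4 + 8 * c ^ 4 * ∫ z, ‖z‖ ^ 4 ∂(stdGaussian E) := by
        rw [integral_add (integrable_const _) (hint.const_mul _), integral_const,
          integral_const_mul (8 * c ^ 4)]
        simp
    _ ≤ 8 * ‖a‖ ^ 4 + 8 * c ^ 4 * (3 * Module.finrank ℝ E ^ 2) := by
        gcongr
        exact integral_norm_pow_four_stdGaussian_le
    _ = _ := by ring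

end FourthMoment

section GaussianSample

variable {E : Type*} [NormedAddCommGroup E] [InnerProductSpace ℝ E] [FiniteDimensional ℝ E]
  [MeasurableSpace E] [BorelSpace E]

/-- The law of independent points, indexed by `ι`, that are normally distributed with mean `μ` and
unit covariance. -/
def gaussianSample (ι : Type*) [Fintype ι] (μ : E) : Measure (ι → E) :=
  Measure.pi fun _ => (stdGaussian E).map fun z => μ + z

variable {ι : Type*} [Fintype ι]

lemma hasGaussianLaw_gaussianSample (μ : E) :
    HasGaussianLaw (fun (x : ι → E) i => x i) (gaussianSample ι μ) := by
  refine iIndepFun.hasGaussianLaw (X := fun i (x : ι → E) => x i) (fun i => ?_)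
    (iIndepFun_pi (X := fun _ => id) fun _ => aemeasurable_id)
  have : IsGaussian ((gaussianSample ι μ).map fun x => x i) := by
    rw [gaussianSample, (measurePreserving_eval _ i).map_eq]
    infer_instance
  exact IsGaussian.hasGaussianLaw

instance isGaussian_gaussianSample (μ : E) : IsGaussian (gaussianSample ι μ) := by
  simpa only [Measure.map_id'] using (hasGaussianLaw_gaussianSample (ι := ι) μ).isGaussian_map

lemma memLp_eval_gaussianSample (μ : E) (i : ι) {p : ℝ≥0∞} (hp : p ≠ ∞) :
    MemLp (fun x : ι → E => x i) p (gaussianSample ι μ) :=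
  ((hasGaussianLaw_gaussianSample μ).eval i).memLp hp

lemma memLp_sampleMean (μ : E) {p : ℝ≥0∞} (hp : p ≠ ∞) :
    MemLp (sampleMean : (ι → E) → E) p (gaussianSample ι μ) := by
  have h := ((hasGaussianLaw_gaussianSample (ι := ι) μ).map_fun (sampleMeanL ι E)).memLp hp
  simpa only [sampleMeanL_apply] using h

lemma memLp_inner_eval (μ a : E) (i : ι) :
    MemLp (fun x : ι → E => inner ℝ a (x i)) 2 (gaussianSample ι μ) :=
  (memLp_eval_gaussianSample μ i ENNReal.ofNat_ne_top).const_inner a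

lemma memLp_inner_sampleMean (μ a : E) :
    MemLp (fun x : ι → E => inner ℝ a (sampleMean x)) 2 (gaussianSample ι μ) :=
  (memLp_sampleMean μ ENNReal.ofNat_ne_top).const_inner a

lemma integral_inner_eval (μ a : E) (i : ι) :
    ∫ x : ι → E, inner ℝ a (x i) ∂(gaussianSample ι μ) = inner ℝ a μ := by
  rw [gaussianSample, integral_comp_eval (μ := fun _ : ι => (stdGaussian E).map fun z => μ + z)
    (f := fun y => inner ℝ a y) (by fun_prop), integral_map (by fun_prop) (by fun_prop)]
  simp_rw [inner_add_right]
  exact integral_add_inner_stdGaussian _ _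

lemma covariance_inner_eval [DecidableEq ι] (μ a b : E) (i j : ι) :
    cov[fun x : ι → E => inner ℝ a (x i), fun x => inner ℝ b (x j); gaussianSample ι μ] =
      if i = j then inner ℝ a b else 0 := by
  split_ifs with h
  · subst h
    rw [← covariance_map_fun (Z := fun x : ι → E => x i) (X := fun y => inner ℝ a y)
      (Y := fun y => inner ℝ b y) (by fun_prop) (by fun_prop)
      (measurable_pi_apply i).aemeasurable, gaussianSample, (measurePreserving_eval _ i).map_eq,
      ← covarianceBilin_apply_eq_cov IsGaussian.memLp_two_id,
      covarianceBilin_map_const_add, covarianceBilin_stdGaussian, innerSL_apply_apply]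
  · have hind : iIndepFun (fun i (x : ι → E) => x i) (gaussianSample ι μ) :=
      iIndepFun_pi (X := fun _ => id) fun _ => aemeasurable_id
    exact ((hind.indepFun h).comp (φ := fun y => inner ℝ a y) (ψ := fun y => inner ℝ b y)
      (by fun_prop) (by fun_prop)).covariance_eq_zero (memLp_inner_eval μ a i)
      (memLp_inner_eval μ b j)

lemma covariance_inner_eval_sampleMean (μ a b : E) (i : ι) :
    cov[fun x : ι → E => inner ℝ a (x i), fun x => inner ℝ b (sampleMean x);
      gaussianSample ι μ] = (Fintype.card ι : ℝ)⁻¹ * inner ℝ a b := by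
  classical
  simp_rw [inner_sampleMean]
  rw [covariance_const_mul_right, covariance_fun_sum_right (fun j => memLp_inner_eval μ b j)
    (memLp_inner_eval μ a i)]
  simp_rw [covariance_inner_eval, Finset.sum_ite_eq, Finset.mem_univ, if_true]

variable [Nonempty ι]

lemma integral_inner_sampleMean (μ a : E) :
    ∫ x : ι → E, inner ℝ a (sampleMean x) ∂(gaussianSample ι μ) = inner ℝ a μ := by
  have hι : (Fintype.card ι : ℝ) ≠ 0 := Nat.cast_ne_zero.2 Fintype.card_ne_zero
  simp_rw [inner_sampleMean, integral_const_mul, integral_finsetSum _ fun i _ =>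
    (memLp_inner_eval μ a i).integrable one_le_two, integral_inner_eval, Finset.sum_const,
    Finset.card_univ, nsmul_eq_mul, inv_mul_cancel_left₀ hι]

lemma covariance_inner_sampleMean (μ a b : E) :
    cov[fun x : ι → E => inner ℝ a (sampleMean x), fun x => inner ℝ b (sampleMean x);
      gaussianSample ι μ] = (Fintype.card ι : ℝ)⁻¹ * inner ℝ a b := by
  have hι : (Fintype.card ι : ℝ) ≠ 0 := Nat.cast_ne_zero.2 Fintype.card_ne_zero
  have h := funext fun x : ι → E => inner_sampleMean a x
  simp_rw [h, covariance_const_mul_left, covariance_fun_sum_left (fun j => memLp_inner_eval μ a j)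
    (memLp_inner_sampleMean μ b), covariance_inner_eval_sampleMean, Finset.sum_const,
    Finset.card_univ, nsmul_eq_mul, inv_mul_cancel_left₀ hι]

lemma map_sampleMean_gaussianSample (μ : E) :
    (gaussianSample ι μ).map sampleMean =
      (stdGaussian E).map fun z => μ + (√(Fintype.card ι : ℝ))⁻¹ • z := by
  have hmean : (sampleMean : (ι → E) → E) = sampleMeanL ι E :=
    funext fun x => (sampleMeanL_apply x).symm
  set c := (√(Fintype.card ι : ℝ))⁻¹ with hc
  have hcsq : c * c = (Fintype.card ι : ℝ)⁻¹ := by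
    rw [hc, ← mul_inv, Real.mul_self_sqrt (Nat.cast_nonneg _)]
  have hinner (a z : E) : inner ℝ a (μ + c • z) = inner ℝ a μ + inner ℝ (c • a) z := by
    rw [inner_add_right, inner_smul_right, real_inner_smul_left]
  have hG₁ : IsGaussian ((gaussianSample ι μ).map sampleMean) := by
    rw [hmean]
    infer_instance
  have hG₂ : IsGaussian ((stdGaussian E).map fun z => μ + c • z) := by
    have h : IsGaussian (((stdGaussian E).map
        (c • ContinuousLinearMap.id ℝ E)).map fun z => μ + z) := inferInstance
    rwa [Measure.map_map (by fun_prop) (by fun_prop)] at h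
  refine IsGaussian.ext (ext_inner_left ℝ fun a => ?_) ?_
  · rw [← integral_inner IsGaussian.integrable_id, ← integral_inner IsGaussian.integrable_id,
      integral_map (by fun_prop) (by fun_prop), integral_map (by fun_prop) (by fun_prop)]
    simp only [id, hinner, integral_inner_sampleMean, integral_add_inner_stdGaussian]
  · ext a b
    rw [covarianceBilin_apply_eq_cov IsGaussian.memLp_two_id,
      covarianceBilin_apply_eq_cov IsGaussian.memLp_two_id,
      covariance_map_fun (by fun_prop) (by fun_prop) (by fun_prop),
      covariance_map_fun (by fun_prop) (by fun_prop) (by fun_prop), covariance_inner_sampleMean]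
    have hint (v : E) : Integrable (fun z => inner ℝ v z) (stdGaussian E) :=
      IsGaussian.integrable_id.const_inner v
    simp_rw [hinner]
    rw [covariance_const_add_left (hint _), covariance_const_add_right (hint _),
      ← covarianceBilin_apply_eq_cov IsGaussian.memLp_two_id, covarianceBilin_stdGaussian,
      innerSL_apply_apply, real_inner_smul_left, inner_smul_right, ← mul_assoc, hcsq]

lemma integral_comp_sampleMean (μ : E) {f : E → ℝ} (hf : Continuous f) :
    ∫ x, f (sampleMean x) ∂(gaussianSample ι μ) =
      ∫ z, f (μ + (√(Fintype.card ι : ℝ))⁻¹ • z) ∂(stdGaussian E) := by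
  rw [← integral_map (φ := sampleMean) (by fun_prop) hf.aestronglyMeasurable,
    map_sampleMean_gaussianSample, integral_map (by fun_prop) hf.aestronglyMeasurable]

lemma integral_norm_sampleMean_sq (μ : E) :
    ∫ x : ι → E, ‖sampleMean x‖ ^ 2 ∂(gaussianSample ι μ) =
      ‖μ‖ ^ 2 + Module.finrank ℝ E / Fintype.card ι := by
  rw [integral_comp_sampleMean μ (f := fun y => ‖y‖ ^ 2) (by fun_prop)]
  have h := integral_norm_add_apply_sq_stdGaussian (stdOrthonormalBasis ℝ E) μ
    ((√(Fintype.card ι : ℝ))⁻¹ • ContinuousLinearMap.id ℝ E)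
  simpa [norm_smul, mul_pow, div_eq_mul_inv] using h

lemma integral_norm_sampleMean_pow_four_le (μ : E) :
    ∫ x : ι → E, ‖sampleMean x‖ ^ 4 ∂(gaussianSample ι μ) ≤
      8 * ‖μ‖ ^ 4 + 24 * (Module.finrank ℝ E / Fintype.card ι) ^ 2 := by
  rw [integral_comp_sampleMean μ (f := fun y => ‖y‖ ^ 4) (by fun_prop)]
  refine (integral_norm_add_smul_pow_four_stdGaussian_le _ _).trans_eq ?_
  rw [inv_pow, Real.sq_sqrt (Nat.cast_nonneg _), inv_mul_eq_div]

lemma indepFun_sub_sampleMean (μ : E) (i : ι) :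
    IndepFun (fun x : ι → E => x i - sampleMean x) sampleMean (gaussianSample ι μ) := by
  refine HasGaussianLaw.indepFun_of_covariance_inner ?_ fun a b => ?_
  · have h := (hasGaussianLaw_gaussianSample (ι := ι) μ).map_fun
      ((ContinuousLinearMap.proj i - sampleMeanL ι E).prod (sampleMeanL ι E))
    simpa [sampleMeanL_apply] using h
  · simp_rw [inner_sub_right]
    rw [covariance_fun_sub_left (memLp_inner_eval μ a i) (memLp_inner_sampleMean μ a)
      (memLp_inner_sampleMean μ b), covariance_inner_eval_sampleMean,
      covariance_inner_sampleMean, sub_self]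

lemma integral_inner_sub_sampleMean_sq (μ v : E) (i : ι) :
    ∫ x : ι → E, inner ℝ (x i - sampleMean x) v ^ 2 ∂(gaussianSample ι μ) =
      (1 - (Fintype.card ι : ℝ)⁻¹) * ‖v‖ ^ 2 := by
  classical
  have hx := memLp_inner_eval μ v i
  have hm := memLp_inner_sampleMean (ι := ι) μ v
  have hmean : ∫ x : ι → E, (inner ℝ v (x i) - inner ℝ v (sampleMean x)) ∂(gaussianSample ι μ) =
      0 := by
    rw [integral_sub (hx.integrable one_le_two) (hm.integrable one_le_two), integral_inner_eval,
      integral_inner_sampleMean, sub_self]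
  have hsub : MemLp (fun x : ι → E => inner ℝ v (x i) - inner ℝ v (sampleMean x)) 2
      (gaussianSample ι μ) := hx.sub hm
  simp_rw [real_inner_comm v, inner_sub_right]
  rw [← variance_of_integral_eq_zero hsub.aemeasurable hmean, variance_fun_sub hx hm,
    ← covariance_self hx.aemeasurable, ← covariance_self hm.aemeasurable,
    covariance_inner_eval_sampleMean, covariance_inner_eval, if_pos rfl,
    covariance_inner_sampleMean, real_inner_self_eq_norm_sq]
  ring

end GaussianSample

section IndepFun

variable {E Ω : Type*} [NormedAddCommGroup E] [InnerProductSpace ℝ E]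
  [MeasurableSpace E] [BorelSpace E] {mΩ : MeasurableSpace Ω} {P : Measure Ω}
  {Y Z : Ω → E}

lemma integrable_inner_sq_of_indepFun (hY : MemLp Y 2 P) (hZ : MemLp Z 2 P)
    (hind : IndepFun Y Z P) : Integrable (fun ω => inner ℝ (Y ω) (Z ω) ^ 2) P := by
  have hprod : Integrable (fun ω => ‖Y ω‖ ^ 2 * ‖Z ω‖ ^ 2) P :=
    (hind.comp (φ := fun y => ‖y‖ ^ 2) (ψ := fun z => ‖z‖ ^ 2) (by fun_prop)
      (by fun_prop)).integrable_mul (hY.integrable_norm_pow two_ne_zero)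
      (hZ.integrable_norm_pow two_ne_zero)
  refine hprod.mono' ((hY.aestronglyMeasurable.inner hZ.aestronglyMeasurable).pow 2)
    (ae_of_all _ fun ω => ?_)
  rw [norm_pow, ← mul_pow]
  exact pow_le_pow_left₀ (norm_nonneg _) (norm_inner_le_norm _ _) 2

lemma integral_inner_sq_of_indepFun [SecondCountableTopology E] [IsProbabilityMeasure P]
    (hY : MemLp Y 2 P) (hZ : MemLp Z 2 P) (hind : IndepFun Y Z P) {C : ℝ}
    (hC : ∀ v, ∫ ω, inner ℝ (Y ω) v ^ 2 ∂P = C * ‖v‖ ^ 2) :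
    ∫ ω, inner ℝ (Y ω) (Z ω) ^ 2 ∂P = C * ∫ ω, ‖Z ω‖ ^ 2 ∂P := by
  have hYm := hY.aestronglyMeasurable.aemeasurable
  have hZm := hZ.aestronglyMeasurable.aemeasurable
  have hf : Continuous fun p : E × E => inner ℝ p.1 p.2 ^ 2 := by fun_prop
  have : IsProbabilityMeasure (P.map Y) := Measure.isProbabilityMeasure_map hYm
  have : IsProbabilityMeasure (P.map Z) := Measure.isProbabilityMeasure_map hZm
  have hjoint := (indepFun_iff_map_prod_eq_prod_map_map hYm hZm).1 hind
  have hint : Integrable (fun p : E × E => inner ℝ p.1 p.2 ^ 2)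
      ((P.map Y).prod (P.map Z)) := by
    rw [← hjoint, integrable_map_measure hf.aestronglyMeasurable (hYm.prodMk hZm)]
    exact integrable_inner_sq_of_indepFun hY hZ hind
  calc ∫ ω, inner ℝ (Y ω) (Z ω) ^ 2 ∂P
      = ∫ p, inner ℝ p.1 p.2 ^ 2 ∂((P.map Y).prod (P.map Z)) := by
        rw [← hjoint, integral_map (hYm.prodMk hZm) hf.aestronglyMeasurable]
    _ = ∫ v, ∫ y, inner ℝ y v ^ 2 ∂(P.map Y) ∂(P.map Z) := integral_prod_symm _ hint
    _ = ∫ v, C * ‖v‖ ^ 2 ∂(P.map Z) :=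
        integral_congr_ae (ae_of_all _ fun v => by
          dsimp only
          rw [integral_map hYm (by fun_prop), hC])
    _ = C * ∫ ω, ‖Z ω‖ ^ 2 ∂P := by
        rw [integral_const_mul, integral_map hZm (by fun_prop)]

end IndepFun

section Expectation

variable {ι E : Type*} [Fintype ι] [NormedAddCommGroup E] [InnerProductSpace ℝ E]
  [FiniteDimensional ℝ E] [MeasurableSpace E] [BorelSpace E]

lemma memLp_sub_sampleMean (μ : E) (i : ι) :
    MemLp (fun x : ι → E => x i - sampleMean x) 2 (gaussianSample ι μ) :=
  (memLp_eval_gaussianSample μ i ENNReal.ofNat_ne_top).sub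
    (memLp_sampleMean μ ENNReal.ofNat_ne_top)

lemma integrable_norm_sampleMean_pow (μ : E) {p : ℕ} (hp : p ≠ 0) :
    Integrable (fun x : ι → E => ‖sampleMean x‖ ^ p) (gaussianSample ι μ) :=
  (memLp_sampleMean μ (ENNReal.natCast_ne_top p)).integrable_norm_pow hp

lemma integrable_genErr_bound (μ : E) :
    Integrable (fun x : ι → E => 2 * ‖μ‖ ^ 2 + 2 * ‖sampleMean x‖ ^ 2 +
      2 * (Module.finrank ℝ E : ℝ) + 4 * ((Fintype.card ι : ℝ)⁻¹ * ∑ i, ‖x i‖ ^ 2))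
      (gaussianSample ι μ) := by
  have hmean : Integrable (fun x : ι → E => ‖sampleMean x‖ ^ 2) (gaussianSample ι μ) :=
    integrable_norm_sampleMean_pow μ two_ne_zero
  have hpoint (i : ι) : Integrable (fun x : ι → E => ‖x i‖ ^ 2) (gaussianSample ι μ) :=
    (memLp_eval_gaussianSample μ i ENNReal.ofNat_ne_top).integrable_norm_pow two_ne_zero
  fun_prop

variable [Nonempty ι]

lemma integrable_inner_sub_sampleMean_self_sq (μ : E) (i : ι) :
    Integrable (fun x : ι → E => inner ℝ (x i - sampleMean x) (sampleMean x) ^ 2)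
      (gaussianSample ι μ) :=
  integrable_inner_sq_of_indepFun (memLp_sub_sampleMean μ i)
    (memLp_sampleMean μ ENNReal.ofNat_ne_top) (indepFun_sub_sampleMean μ i)

lemma integral_inner_sub_sampleMean_self_sq (μ : E) (i : ι) :
    ∫ x : ι → E, inner ℝ (x i - sampleMean x) (sampleMean x) ^ 2 ∂(gaussianSample ι μ) =
      (1 - (Fintype.card ι : ℝ)⁻¹) * (‖μ‖ ^ 2 + Module.finrank ℝ E / Fintype.card ι) := by
  rw [← integral_norm_sampleMean_sq]
  exact integral_inner_sq_of_indepFun (memLp_sub_sampleMean μ i)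
    (memLp_sampleMean μ ENNReal.ofNat_ne_top) (indepFun_sub_sampleMean μ i)
    fun v => integral_inner_sub_sampleMean_sq μ v i

lemma integrable_inv_card_mul_sum_inner_sq (μ : E) :
    Integrable (fun x : ι → E => (Fintype.card ι : ℝ)⁻¹ *
      ∑ i, inner ℝ (x i - sampleMean x) (sampleMean x) ^ 2) (gaussianSample ι μ) :=
  (integrable_finsetSum _ fun i _ => integrable_inner_sub_sampleMean_self_sq μ i).const_mul _

lemma integral_inv_card_mul_sum_inner_sq (μ : E) :
    ∫ x : ι → E, (Fintype.card ι : ℝ)⁻¹ *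
      ∑ i, inner ℝ (x i - sampleMean x) (sampleMean x) ^ 2 ∂(gaussianSample ι μ) =
      (1 - (Fintype.card ι : ℝ)⁻¹) * (‖μ‖ ^ 2 + Module.finrank ℝ E / Fintype.card ι) := by
  have hι : (Fintype.card ι : ℝ) ≠ 0 := Nat.cast_ne_zero.2 Fintype.card_ne_zero
  rw [integral_const_mul,
    integral_finsetSum _ fun i _ => integrable_inner_sub_sampleMean_self_sq μ i]
  simp_rw [integral_inner_sub_sampleMean_self_sq, Finset.sum_const, Finset.card_univ,
    nsmul_eq_mul, inv_mul_cancel_left₀ hι]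

lemma integrable_genErr (μ : E) {ρ T : ℝ} (hρ : 0 ≤ ρ) (hρ1 : ρ ≤ 1) (hT : 1 ≤ T) :
    Integrable (genErr μ ρ T) (gaussianSample ι μ) := by
  refine (integrable_genErr_bound μ).mono'
    (measurable_genErr μ ρ (zero_lt_one.trans_le hT)).aestronglyMeasurable (ae_of_all _ fun x => ?_)
  rw [Real.norm_of_nonneg (genErr_nonneg _ _ _ _)]
  exact genErr_le μ hρ hρ1 hT x

lemma integrable_genErrLim (μ : E) {ρ : ℝ} (hρ : 0 ≤ ρ) (hρ1 : ρ ≤ 1) :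
    Integrable (genErrLim μ ρ) (gaussianSample ι μ) := by
  refine (integrable_genErr_bound μ).mono' (measurable_genErrLim μ ρ).aestronglyMeasurable
    (ae_of_all _ fun x => ?_)
  refine le_of_tendsto (tendsto_genErr μ ρ x).norm ?_
  filter_upwards [eventually_ge_atTop 1] with T hT
  rw [Real.norm_of_nonneg (genErr_nonneg _ _ _ _)]
  exact genErr_le μ hρ hρ1 hT x

lemma tendsto_integral_genErr (μ : E) {ρ : ℝ} (hρ : 0 ≤ ρ) (hρ1 : ρ ≤ 1) :
    Tendsto (fun T => ∫ x, genErr μ ρ T x ∂(gaussianSample ι μ)) atTop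
      (nhds (∫ x, genErrLim μ ρ x ∂(gaussianSample ι μ))) := by
  refine tendsto_integral_filter_of_dominated_convergence _ ?_ ?_ (integrable_genErr_bound μ)
    (ae_of_all _ fun x => tendsto_genErr μ ρ x)
  · filter_upwards [eventually_ge_atTop 1] with T hT
    exact (integrable_genErr μ hρ hρ1 hT).aestronglyMeasurable
  · filter_upwards [eventually_ge_atTop 1] with T hT
    refine ae_of_all _ fun x => ?_
    rw [Real.norm_of_nonneg (genErr_nonneg _ _ _ _)]
    exact genErr_le μ hρ hρ1 hT x

lemma integrable_sqrtGain (μ : E) {ρ : ℝ} (hρ : 0 ≤ ρ) (hρ1 : ρ ≤ 1) :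
    Integrable (sqrtGain ρ : (ι → E) → ℝ) (gaussianSample ι μ) := by
  have h (x : ι → E) : sqrtGain ρ x = 2⁻¹ * (genErrLim μ 0 x - genErrLim μ ρ x -
      ρ * (1 - ρ) * ‖sampleMean x‖ ^ 2 + 2 * ρ * inner ℝ μ (sampleMean x)) := by
    rw [genErrLim_zero_sub μ hρ]
    ring
  rw [funext h]
  exact ((((integrable_genErrLim μ le_rfl zero_le_one).sub (integrable_genErrLim μ hρ hρ1)).sub
    ((integrable_norm_sampleMean_pow μ two_ne_zero).const_mul _)).add
    (((memLp_inner_sampleMean μ μ).integrable one_le_two).const_mul _)).const_mul _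

lemma integral_genErrLim_zero_sub (μ : E) {ρ : ℝ} (hρ : 0 ≤ ρ) (hρ1 : ρ ≤ 1) :
    ∫ x : ι → E, (genErrLim μ 0 x - genErrLim μ ρ x) ∂(gaussianSample ι μ) =
      Module.finrank ℝ E / Fintype.card ι * (ρ * (1 - ρ)) - ρ * (1 + ρ) * ‖μ‖ ^ 2 +
        2 * ∫ x : ι → E, sqrtGain ρ x ∂(gaussianSample ι μ) := by
  have hnorm : Integrable (fun x : ι → E => ρ * (1 - ρ) * ‖sampleMean x‖ ^ 2)
      (gaussianSample ι μ) :=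
    (integrable_norm_sampleMean_pow μ two_ne_zero).const_mul _
  have hinner : Integrable (fun x : ι → E => 2 * ρ * inner ℝ μ (sampleMean x))
      (gaussianSample ι μ) :=
    ((memLp_inner_sampleMean μ μ).integrable one_le_two).const_mul _
  have hdiff : Integrable (fun x : ι → E => ρ * (1 - ρ) * ‖sampleMean x‖ ^ 2 -
      2 * ρ * inner ℝ μ (sampleMean x)) (gaussianSample ι μ) := hnorm.sub hinner
  simp_rw [genErrLim_zero_sub μ hρ]
  rw [integral_add hdiff ((integrable_sqrtGain μ hρ hρ1).const_mul 2),
    integral_sub hnorm hinner, integral_const_mul, integral_const_mul, integral_const_mul,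
    integral_norm_sampleMean_sq, integral_inner_sampleMean, real_inner_self_eq_norm_sq]
  ring

lemma le_integral_sqrtGain (μ : E) {ρ : ℝ} (hρ : 0 ≤ ρ) (hρ1 : ρ ≤ 1) :
    ρ / 4 * (2 * (‖μ‖ ^ 2 + Module.finrank ℝ E / Fintype.card ι) -
      ρ * (8 * ‖μ‖ ^ 4 + 24 * (Module.finrank ℝ E / Fintype.card ι) ^ 2)) ≤
      ∫ x : ι → E, sqrtGain ρ x ∂(gaussianSample ι μ) := by
  have hsq : Integrable (fun x : ι → E => 3 * ‖sampleMean x‖ ^ 2) (gaussianSample ι μ) :=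
    (integrable_norm_sampleMean_pow μ two_ne_zero).const_mul 3
  have hcross := integrable_inv_card_mul_sum_inner_sq (ι := ι) μ
  have hfour : Integrable (fun x : ι → E => ρ * ‖sampleMean x‖ ^ 4) (gaussianSample ι μ) :=
    (integrable_norm_sampleMean_pow μ four_ne_zero).const_mul ρ
  have hdiff : Integrable (fun x : ι → E => 3 * ‖sampleMean x‖ ^ 2 - (Fintype.card ι : ℝ)⁻¹ *
      ∑ i, inner ℝ (x i - sampleMean x) (sampleMean x) ^ 2) (gaussianSample ι μ) := hsq.sub hcross
  calc _ ≤ ∫ x : ι → E, ρ / 4 * (3 * ‖sampleMean x‖ ^ 2 -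
        (Fintype.card ι : ℝ)⁻¹ * ∑ i, inner ℝ (x i - sampleMean x) (sampleMean x) ^ 2 -
        ρ * ‖sampleMean x‖ ^ 4) ∂(gaussianSample ι μ) := by
        rw [integral_const_mul, integral_sub hdiff hfour, integral_sub hsq hcross,
          integral_const_mul 3, integral_const_mul ρ, integral_inv_card_mul_sum_inner_sq,
          integral_norm_sampleMean_sq]
        set s := ‖μ‖ ^ 2 + (Module.finrank ℝ E : ℝ) / Fintype.card ι
        have hcross_le : (1 - (Fintype.card ι : ℝ)⁻¹) * s ≤ s :=
          mul_le_of_le_one_left (by positivity) (sub_le_self _ (by positivity))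
        have hfour_le := mul_le_mul_of_nonneg_left
          (integral_norm_sampleMean_pow_four_le (ι := ι) μ) hρ
        exact mul_le_mul_of_nonneg_left (by linarith) (by positivity)
    _ ≤ ∫ x : ι → E, sqrtGain ρ x ∂(gaussianSample ι μ) :=
        integral_mono ((hdiff.sub hfour).const_mul _) (integrable_sqrtGain μ hρ hρ1)
          (le_sqrtGain hρ)

end Expectation

/-! ### The lower bound for the expected gain -/

/-- A constant for which `c * gainConst B ≤ 1 / 4`, together with `ρ ≤ c` and `ρ ≤ c * q`, absorbs
the terms of second order in `ρ` in the expected gain, when `‖μ‖ ^ 2 ≤ B`. -/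
def gainConst (B : ℝ) : ℝ := 1 + |B| + 196 * B ^ 2

lemma one_le_gainConst (B : ℝ) : 1 ≤ gainConst B := by
  unfold gainConst
  linarith [abs_nonneg B, sq_nonneg B]

-- For `4 * B ≤ q` the mean alone wins and `S ≥ 0` suffices; otherwise `q` is bounded in terms of
-- `B`, and the first-order part of `S` cancels the loss `ρ * b` of the mean.
lemma le_gain {B b q ρ c S : ℝ} (hb : 0 ≤ b) (hbB : b ≤ B) (hρ : 0 ≤ ρ)
    (hc : c * gainConst B ≤ 1 / 4) (hρc : ρ ≤ c) (hρq : ρ ≤ c * q) (hS : 0 ≤ S)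
    (hSρ : ρ / 4 * (2 * (b + q) - ρ * (8 * b ^ 2 + 24 * q ^ 2)) ≤ S) (hq : 0 ≤ q) :
    7 / 16 * (ρ * q) ≤ q * (ρ * (1 - ρ)) - ρ * (1 + ρ) * b + 2 * S := by
  have hB : 0 ≤ B := hb.trans hbB
  have hc0 : 0 ≤ c := hρ.trans hρc
  have hρ4 : ρ ≤ 1 / 4 :=
    hρc.trans ((le_mul_of_one_le_right hc0 (one_le_gainConst B)).trans hc)
  have hsecond : ρ * q * ρ ≤ ρ * q * (1 / 4) := by gcongr
  rcases le_total (4 * B) q with hlarge | hsmall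
  · have hmean : ρ * ((1 + ρ) * b) ≤ ρ * ((1 + 1 / 4) * (q / 4)) := by
      gcongr
      linarith
    nlinarith [mul_nonneg hρ hq]
  · have hconst : b + (4 * b ^ 2 + 12 * q ^ 2) ≤ gainConst B := by
      have hb2 : b ^ 2 ≤ B ^ 2 := by gcongr
      have hq2 : q ^ 2 ≤ (4 * B) ^ 2 := by gcongr
      rw [gainConst, abs_of_nonneg hB]
      linarith
    have hloss : ρ * (ρ * (b + (4 * b ^ 2 + 12 * q ^ 2))) ≤ ρ * (q * (1 / 4)) := by
      refine mul_le_mul_of_nonneg_left ?_ hρ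
      calc ρ * (b + (4 * b ^ 2 + 12 * q ^ 2)) ≤ c * q * gainConst B := by gcongr
        _ = q * (c * gainConst B) := by ring
        _ ≤ q * (1 / 4) := by gcongr
    nlinarith [mul_nonneg hρ hq]

lemma shrinkage_le_one (γ : ℝ) : shrinkage γ ≤ 1 :=
  div_le_one_of_le₀ (by linarith) (by positivity)

lemma shrinkage_le_sq (γ : ℝ) : shrinkage γ ≤ γ ^ 2 :=
  div_le_self (sq_nonneg γ) (by linarith [sq_nonneg γ])

lemma le_shrinkage {γ : ℝ} (hγ : γ ^ 2 ≤ 1 / 4) : 4 / 5 * γ ^ 2 ≤ shrinkage γ := by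
  rw [shrinkage, le_div_iff₀ (by positivity)]
  nlinarith [sq_nonneg γ]

section Expectation

variable {ι E : Type*} [Fintype ι] [Nonempty ι] [NormedAddCommGroup E] [InnerProductSpace ℝ E]
  [FiniteDimensional ℝ E] [MeasurableSpace E] [BorelSpace E]

lemma le_integral_genErrLim_zero_sub {B c : ℝ} {μ : E} (hμ : ‖μ‖ ^ 2 ≤ B)
    (hc : c * gainConst B ≤ 1 / 4) {ρ : ℝ} (hρ : 0 ≤ ρ) (hρc : ρ ≤ c)
    (hρq : ρ ≤ c * (Module.finrank ℝ E / Fintype.card ι)) :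
    7 / 16 * (ρ * (Module.finrank ℝ E / Fintype.card ι)) ≤
      ∫ x : ι → E, (genErrLim μ 0 x - genErrLim μ ρ x) ∂(gaussianSample ι μ) := by
  have hρ1 : ρ ≤ 1 := by
    have := le_mul_of_one_le_right (hρ.trans hρc) (one_le_gainConst B)
    linarith
  rw [integral_genErrLim_zero_sub μ hρ hρ1]
  refine le_gain (sq_nonneg ‖μ‖) hμ hρ hc hρc hρq (integral_nonneg (sqrtGain_nonneg hρ)) ?_
    (by positivity)
  rw [← pow_mul]
  exact le_integral_sqrtGain μ hρ hρ1

lemma integral_genErrLim_zero_sub_gt [Nontrivial E] {B : ℝ} {μ : E} (hμ : ‖μ‖ ^ 2 ≤ B) {γ : ℝ}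
    (hγ : 0 < γ) (hγn : γ ^ 2 ≤ (1 / (2 * gainConst B)) ^ 2 / Fintype.card ι) :
    1 / 4 * (γ ^ 2 * (Module.finrank ℝ E / Fintype.card ι)) <
      ∫ x : ι → E, (genErrLim μ 0 x - genErrLim μ (shrinkage γ) x) ∂(gaussianSample ι μ) := by
  have hG := one_le_gainConst B
  have hcard : (1 : ℝ) ≤ Fintype.card ι := Nat.one_le_cast.2 Fintype.card_pos
  have hrank : (1 : ℝ) ≤ Module.finrank ℝ E := Nat.one_le_cast.2 Module.finrank_pos
  set c := (1 / (2 * gainConst B)) ^ 2 with hcdef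
  have hc0 : 0 ≤ c := sq_nonneg _
  have hc : c * gainConst B ≤ 1 / 4 := by
    have hcG : c * gainConst B = 1 / (4 * gainConst B) := by
      rw [hcdef]
      field_simp
      norm_num
    rw [hcG]
    exact one_div_le_one_div_of_le (by norm_num) (by linarith)
  have hγc : γ ^ 2 ≤ c := hγn.trans (div_le_self hc0 hcard)
  have hρ := shrinkage_le_sq γ
  have hγρ := le_shrinkage (hγc.trans ((le_mul_of_one_le_right hc0 hG).trans hc))
  have hρq : shrinkage γ ≤ c * (Module.finrank ℝ E / Fintype.card ι) := by
    refine hρ.trans (hγn.trans ?_)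
    rw [← mul_div_assoc]
    gcongr
    exact le_mul_of_one_le_right hc0 hrank
  have hq : 0 < (Module.finrank ℝ E / Fintype.card ι : ℝ) := by positivity
  calc 1 / 4 * (γ ^ 2 * (Module.finrank ℝ E / Fintype.card ι))
      < 7 / 16 * (4 / 5 * γ ^ 2 * (Module.finrank ℝ E / Fintype.card ι)) := by
        linarith [mul_pos (pow_pos hγ 2) hq]
    _ ≤ 7 / 16 * (shrinkage γ * (Module.finrank ℝ E / Fintype.card ι)) := by gcongr
    _ ≤ _ := le_integral_genErrLim_zero_sub hμ hc (shrinkage_nonneg γ) (hρ.trans hγc) hρq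

lemma eventually_le_integral_genErr_sub {B : ℝ} {μ : E} (hμ : ‖μ‖ ^ 2 ≤ B) {γ : ℝ} (hγ : 0 ≤ γ)
    (hγn : γ ^ 2 ≤ (1 / (2 * gainConst B)) ^ 2 / Fintype.card ι) :
    ∀ᶠ T in atTop, 1 / 4 * (γ ^ 2 * (Module.finrank ℝ E / Fintype.card ι)) ≤
      ∫ x : ι → E, (genErr μ 0 T x - genErr μ (shrinkage γ) T x) ∂(gaussianSample ι μ) := by
  rcases hγ.eq_or_lt with rfl | hγ
  · simp [shrinkage_zero]
  rcases subsingleton_or_nontrivial E with hE | hE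
  · simp [genErr_eq_zero, Module.finrank_zero_of_subsingleton]
  have hρ := shrinkage_nonneg γ
  have hρ1 := shrinkage_le_one γ
  have hgt := integral_genErrLim_zero_sub_gt hμ hγ hγn
  rw [integral_sub (integrable_genErrLim μ le_rfl zero_le_one)
    (integrable_genErrLim μ hρ hρ1)] at hgt
  filter_upwards [((tendsto_integral_genErr μ le_rfl zero_le_one).sub
    (tendsto_integral_genErr μ hρ hρ1)).eventually_const_lt hgt, eventually_ge_atTop 1]
    with T h hT
  rw [integral_sub (integrable_genErr μ le_rfl zero_le_one hT) (integrable_genErr μ hρ hρ1 hT)]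
  exact h.le

end Expectation

lemma measurePreserving_eval_sampleLaw {K d : ℕ} (G : GaussianMixture K d) (n : Fin K → ℕ)
    (k : Fin K) :
    MeasurePreserving (fun X : Dataset n d => X k) (G.sampleLaw n)
      (gaussianSample (Fin (n k)) (G.μ k)) := by
  have hclass (j : Fin K) : IsProbabilityMeasure (G.classLaw j) := by
    unfold GaussianMixture.classLaw
    infer_instance
  rw [gaussianSample, ← multivariateGaussian_one]
  exact measurePreserving_eval (fun j => Measure.pi fun _ : Fin (n j) => G.classLaw j) k

lemma integrable_toReal_wasserstein2_sq {K d : ℕ} (G : GaussianMixture K d) (n : Fin K → ℕ)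
    (k : Fin K) [NeZero (n k)] (γ : ℝ) {T : ℝ} (hT : 1 ≤ T) :
    Integrable (fun X : Dataset n d =>
      (wasserstein2 (G.classLaw k) (generatedLaw γ T (X k))).toReal ^ 2) (G.sampleLaw n) := by
  simp only [GaussianMixture.classLaw, toReal_wasserstein2_generatedLaw_sq]
  exact (measurePreserving_eval_sampleLaw G n k).integrable_comp_of_integrable
    (integrable_genErr (G.μ k) (shrinkage_nonneg γ) (shrinkage_le_one γ) hT)

lemma integral_toReal_wasserstein2_sq_sub {K d : ℕ} (G : GaussianMixture K d) (n : Fin K → ℕ)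
    (k : Fin K) [NeZero (n k)] (γ : ℝ) {T : ℝ} (hT : 0 < T) :
    ∫ X : Dataset n d, ((wasserstein2 (G.classLaw k) (generatedLaw 0 T (X k))).toReal ^ 2 -
        (wasserstein2 (G.classLaw k) (generatedLaw γ T (X k))).toReal ^ 2) ∂(G.sampleLaw n) =
      ∫ x, (genErr (G.μ k) 0 T x - genErr (G.μ k) (shrinkage γ) T x)
        ∂(gaussianSample (Fin (n k)) (G.μ k)) := by
  have hmp := measurePreserving_eval_sampleLaw G n k
  simp only [GaussianMixture.classLaw, toReal_wasserstein2_generatedLaw_sq, shrinkage_zero]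
  have hmeas : Measurable fun x : Fin (n k) → Euc d =>
      genErr (G.μ k) 0 T x - genErr (G.μ k) (shrinkage γ) T x :=
    (measurable_genErr _ _ hT).sub (measurable_genErr _ _ hT)
  rw [← hmp.map_eq, integral_map hmp.measurable.aemeasurable hmeas.aestronglyMeasurable]

lemma sq_le_div_of_le_div_sqrt {γ c : ℝ} (hγ : 0 ≤ γ) {n : ℕ} (h : γ ≤ c / √n) :
    γ ^ 2 ≤ c ^ 2 / n := by
  calc γ ^ 2 ≤ (c / √n) ^ 2 := by gcongr
    _ = c ^ 2 / n := by rw [div_pow, Real.sq_sqrt (Nat.cast_nonneg n)]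

end

theorem theorem2_general (B : ℝ) :
    ∃ c₀ : ℝ, 0 < c₀ ∧ ∃ κ : ℝ, 0 < κ ∧
      ∀ (K d : ℕ) (G : GaussianMixture K d) (n : Fin K → ℕ) (k : Fin K) (γ : ℝ),
        ‖G.μ k‖ ^ 2 ≤ B → 1 ≤ n k → 0 ≤ γ →
        γ ≤ c₀ / Real.sqrt (n k) →
        ∀ᶠ T : ℝ in atTop,
          ∃ Q Qc : Dataset n d → Measure (Euc d),
            (∀ X Q', IsGenerationLaw G.w X 0 k T Q' ↔ Q' = Q X) ∧
            (∀ X Q', IsGenerationLaw G.w X γ k T Q' ↔ Q' = Qc X) ∧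
            (∀ X, wasserstein2 (G.classLaw k) (Q X) ≠ ∞) ∧
            (∀ X, wasserstein2 (G.classLaw k) (Qc X) ≠ ∞) ∧
            Integrable (fun X => (wasserstein2 (G.classLaw k) (Q X)).toReal ^ 2)
              (G.sampleLaw n) ∧
            Integrable (fun X => (wasserstein2 (G.classLaw k) (Qc X)).toReal ^ 2)
              (G.sampleLaw n) ∧
            κ * (γ ^ 2 * d / n k) ≤
              ∫ X, ((wasserstein2 (G.classLaw k) (Q X)).toReal ^ 2 -
                (wasserstein2 (G.classLaw k) (Qc X)).toReal ^ 2) ∂(G.sampleLaw n) := by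
  have hG := one_le_gainConst B
  refine ⟨1 / (2 * gainConst B), by positivity, 1 / 4, by norm_num, ?_⟩
  intro K d G n k γ hμ hnk hγ hγn
  have hk : NeZero (n k) := NeZero.of_pos hnk
  have hgain := eventually_le_integral_genErr_sub (ι := Fin (n k)) hμ hγ (by
    rw [Fintype.card_fin]
    exact sq_le_div_of_le_div_sqrt hγ hγn)
  rw [Fintype.card_fin, finrank_euclideanSpace_fin] at hgain
  filter_upwards [hgain, eventually_ge_atTop 1] with T hle hT
  have hT0 : 0 < T := zero_lt_one.trans_le hT
  refine ⟨fun X => generatedLaw 0 T (X k), fun X => generatedLaw γ T (X k),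
    fun X _ => isGenerationLaw_iff G.w_pos X 0 k hT0 _,
    fun X _ => isGenerationLaw_iff G.w_pos X γ k hT0 _,
    fun _ => wasserstein2_generatedLaw_ne_top _ _ _ _,
    fun _ => wasserstein2_generatedLaw_ne_top _ _ _ _,
    integrable_toReal_wasserstein2_sq G n k 0 hT, integrable_toReal_wasserstein2_sq G n k γ hT, ?_⟩
  rwa [integral_toReal_wasserstein2_sq_sub G n k γ hT0, mul_div_assoc]

theorem theorem2 (B : ℝ) :
    ∃ c₀ : ℝ, 0 < c₀ ∧ ∃ κ : ℝ, 0 < κ ∧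
      ∀ (K d : ℕ) (G : GaussianMixture K d) (n : Fin K → ℕ) (k : Fin K) (γ : ℝ),
        ‖G.μ k‖ ^ 2 ≤ B → 1 ≤ n k → 0 ≤ γ →
        γ ≤ c₀ / Real.sqrt ((Finset.univ.sup n : ℕ) : ℝ) →
        ∀ᶠ T : ℝ in atTop,
          ∃ Q Qc : Dataset n d → Measure (Euc d),
            (∀ X Q', IsGenerationLaw G.w X 0 k T Q' ↔ Q' = Q X) ∧
            (∀ X Q', IsGenerationLaw G.w X γ k T Q' ↔ Q' = Qc X) ∧
            (∀ X, wasserstein2 (G.classLaw k) (Q X) ≠ ∞) ∧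
            (∀ X, wasserstein2 (G.classLaw k) (Qc X) ≠ ∞) ∧
            Integrable (fun X => (wasserstein2 (G.classLaw k) (Q X)).toReal ^ 2)
              (G.sampleLaw n) ∧
            Integrable (fun X => (wasserstein2 (G.classLaw k) (Qc X)).toReal ^ 2)
              (G.sampleLaw n) ∧
            κ * (γ ^ 2 * d / n k) ≤
              ∫ X, ((wasserstein2 (G.classLaw k) (Q X)).toReal ^ 2 -
                (wasserstein2 (G.classLaw k) (Qc X)).toReal ^ 2) ∂(G.sampleLaw n) := by
  obtain ⟨c₀, hc₀, κ, hκ, h⟩ := theorem2_general B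
  refine ⟨c₀, hc₀, κ, hκ, fun K d G n k γ hμ hnk hγ hγn => h K d G n k γ hμ hnk hγ (hγn.trans ?_)⟩
  have hpos : (0 : ℝ) < n k := Nat.cast_pos.2 hnk
  exact div_le_div_of_nonneg_left hc₀.le (Real.sqrt_pos.2 hpos)
    (Real.sqrt_le_sqrt (mod_cast Finset.le_sup (Finset.mem_univ k)))
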